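/- Let $n\ge 1$ and $\alpha>-1$. Let $\mathbb B^n=\{z\in\mathbb C^n: |z_1|^2+\dots+|z_n|^2<1\}$, let $dv$ be Lebesgue measure on $\mathbb C^n$ normalized so that $v(\mathbb B^n)=1$, and put $dv_\alpha(z)=c_\alpha(1-|z|^2)^\alpha dv(z)$ with $c_\alpha=\frac{\Gamma(n+\alpha+1)}{n!\,\Gamma(\alpha+1)}$. Let $\mathcal H^2_\alpha(\mathbb B^n)$ be the weighted Bergman space, i.e. the subspace of $L^2(\mathbb B^n,v_\alpha)$ of holomorphic functions. For $a\in L^\infty(\mathbb B^n)$ the Toeplitz operator $T_a$ on $\mathcal H^2_\alpha(\mathbb B^n)$ is given by $$T_a f(z)=\int_{\mathbb B^n}a(w)f(w)(1-z\cdot\overline w)^{-(n+\alpha+1)}\,dv_\alpha(w).$$ A symbol $a\in L^\infty(\mathbb B^n)$ is called symmetric separately radial if $a(z)=a(|z_1|,\dots,|z_n|)$ and $a(z_{\sigma(1)},\dots,z_{\sigma(n)})=a(z)$ for almost every $z\in\mathbb B^n$ and every $\sigma\in S_n$. Equivalently, $a$ is invariant (for every group element, almost everywhere) under the action $(\sigma,t)z=(t_1z_{\sigma(1)},\dots,t_nz_{\sigma(n)})$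 of $S_n\rtimes\mathbb T^n$. For $m\in\mathbb Z_+^n$ write $|m|=m_1+\dots+m_n$, $m!=m_1!\cdots m_n!$, and let $e_m(z)=\sqrt{\frac{\Gamma(n+|m|+\alpha+1)}{m!\,\Gamma(n+\alpha+1)}}\,z^m$. Let $\mathcal I=\{\iota\in\mathbb Z_+^n:\iota_1\ge\dots\ge\iota_n\}$, and for $\iota\in\mathcal I$ let $\mathcal I_\iota=\{(\iota_{\sigma(1)},\dots,\iota_{\sigma(n)}):\sigma\in S_n\}$. Let $\tau(\mathbb B^n)=\{r\in\mathbb R^n: r_k\ge 0,\ |r|<1\}$. Then: (1) The C*-algebra generated by the Toeplitz operators $T_a$ on $\mathcal H^2_\alpha(\mathbb B^n)$ with symmetric separately radial symbols $a$ is commutative. (2) $\ell^2(\mathbb Z_+^n)=\bigoplus_{\iota\in\mathcal I}\ell^2(\mathcal I_\iota)$ (orthogonal Hilbert sum), the map $R:\mathcal H^2_\alpha(\mathbb B^n)\to\ell^2(\mathbb Z_+^n)$, $Rf=(\langle f,e_m\rangle)_{m}$, is unitary, and for every symmetric separately radial symbol $a$ the operator $T_a$ is well defined and bounded and $$RT_aR^*=\bigoplus_{\iota\in\mathcal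 I}\gamma_a(\iota)\,I|_{\ell^2(\mathcal I_\iota)};$$ equivalently, $RT_aR^*$ is the operator of multiplication by $\gamma_a$ on $\ell^2(\mathbb Z_+^n)$. Here, for $m\in\mathbb Z_+^n$, the spectral function is given by the (absolutely convergent) integral $$\gamma_a(m)=\frac{2^n\,\Gamma(n+|m|+\alpha+1)}{m!\,\Gamma(\alpha+1)}\int_{\tau(\mathbb B^n)}a(r)\,r^{2m}(1-|r|^2)^\alpha\prod_{k=1}^n r_k\,dr_k .$$ (3) $\gamma_a(m)=\gamma_a(\iota)$ for all $\iota\in\mathcal I$ and $m\in\mathcal I_\iota$. -/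

import Mathlib

open MeasureTheory Filter Topology
open scoped ENNReal ComplexConjugate

/-- The open Euclidean unit ball `𝔹ⁿ = {z ∈ ℂⁿ : |z₁|² + ⋯ + |zₙ|² < 1}`. -/
def unitBall (n : ℕ) : Set (Fin n → ℂ) := {z | ∑ i, ‖z i‖ ^ 2 < 1}

/-- The constant `c_α = Γ(n + α + 1) / (n! Γ(α + 1))`. -/
noncomputable def weightConst (n : ℕ) (α : ℝ) : ℝ :=
  Real.Gamma (n + α + 1) / (n.factorial * Real.Gamma (α + 1))

/-- The weighted measure `dv_α(z) = c_α (1 - |z|²)^α dv(z)` on the unit ball, where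
`dv = (n! / πⁿ) dz` is Lebesgue measure on `ℂⁿ` normalized so that `v(𝔹ⁿ) = 1`. -/
noncomputable def weightedMeasure (n : ℕ) (α : ℝ) : Measure (Fin n → ℂ) :=
  ENNReal.ofReal (weightConst n α * (n.factorial / Real.pi ^ n)) •
    (volume.restrict (unitBall n)).withDensity
      (fun z => ENNReal.ofReal ((1 - ∑ i, ‖z i‖ ^ 2) ^ α))

/-- The weighted Bergman space: the (classes of) functions in `L²(𝔹ⁿ, v_α)` that are represented
by a holomorphic function on `𝔹ⁿ`. -/
noncomputable def bergmanSpace (n : ℕ) (α : ℝ) :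
    Submodule ℂ (Lp ℂ 2 (weightedMeasure n α)) where
  carrier := {f | ∃ g : (Fin n → ℂ) → ℂ,
    DifferentiableOn ℂ g (unitBall n) ∧ f =ᵐ[weightedMeasure n α] g}
  zero_mem' := ⟨0, differentiableOn_const 0, Lp.coeFn_zero _ _ _⟩
  add_mem' := by
    rintro f₁ f₂ ⟨g₁, h₁, e₁⟩ ⟨g₂, h₂, e₂⟩
    exact ⟨g₁ + g₂, h₁.add h₂, (Lp.coeFn_add f₁ f₂).trans (e₁.add e₂)⟩
  smul_mem' := by
    rintro c f ⟨g, h, e⟩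
    exact ⟨c • g, h.const_smul c, (Lp.coeFn_smul c f).trans (e.const_smul c)⟩

section Completeness

lemma isOpen_unitBall (n : ℕ) : IsOpen (unitBall n) :=
  isOpen_lt (by fun_prop) continuous_const

lemma two_pi_mul_enorm_le_lintegral_circle {n : ℕ} {f : (Fin n → ℂ) → ℂ} {z w : Fin n → ℂ} {r : ℝ}
    (hf : DifferentiableOn ℂ f (Metric.ball z r)) (hw : w ∈ Metric.ball (0 : Fin n → ℂ) r) :
    ENNReal.ofReal (2 * Real.pi) * ‖f z‖ₑ ≤
      ∫⁻ θ in Set.Ioc 0 (2 * Real.pi), ‖f (z + circleMap 0 1 θ • w)‖ₑ := by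
  have hw' : ‖w‖ < r := by simpa using hw
  have hmaps : Set.MapsTo (fun ζ : ℂ => z + ζ • w) (Metric.closedBall 0 1) (Metric.ball z r) := by
    intro ζ hζ
    have : ‖ζ‖ ≤ 1 := by simpa using hζ
    simp only [Metric.mem_ball, dist_self_add_left, norm_smul]
    nlinarith [norm_nonneg w]
  have hd : DifferentiableOn ℂ (fun ζ : ℂ => f (z + ζ • w)) (Metric.closedBall 0 1) :=
    hf.comp (by fun_prop) hmaps
  have hdc : DiffContOnCl ℂ (fun ζ : ℂ => f (z + ζ • w)) (Metric.ball 0 |1|) := by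
    refine ⟨hd.mono ?_, hd.continuousOn.mono ?_⟩
    · rw [abs_one]; exact Metric.ball_subset_closedBall
    · rw [abs_one]; exact Metric.closure_ball_subset_closedBall
  have h := hdc.circleAverage
  rw [Real.circleAverage, intervalIntegral.integral_of_le Real.two_pi_pos.le] at h
  simp only [zero_smul, add_zero] at h
  have h2 : (2 * Real.pi) • f z =
      ∫ θ in Set.Ioc 0 (2 * Real.pi), f (z + circleMap 0 1 θ • w) := by
    rw [← h, smul_smul, mul_inv_cancel₀ Real.two_pi_pos.ne', one_smul]
  calc ENNReal.ofReal (2 * Real.pi) * ‖f z‖ₑ = ‖(2 * Real.pi) • f z‖ₑ := by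
        rw [enorm_smul, Real.enorm_eq_ofReal Real.two_pi_pos.le]
    _ ≤ _ := by rw [h2]; exact enorm_integral_le_lintegral_enorm _

lemma measurePreserving_circleMap_smul {n : ℕ} (θ : ℝ) :
    MeasurePreserving (fun w : Fin n → ℂ => circleMap 0 1 θ • w) volume volume := by
  have h1 : MeasurePreserving (fun x : ℂ => circleMap 0 1 θ * x) volume volume := by
    have := (rotation (Circle.exp θ)).measurePreserving
    have he : (fun x : ℂ => circleMap 0 1 θ * x) = rotation (Circle.exp θ) := by
      funext x
      simp [circleMap, rotation_apply, Circle.coe_exp]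
    rw [he]
    exact this
  exact volume_preserving_pi (fun _ : Fin n => h1)

lemma enorm_mul_volume_le_lintegral {n : ℕ} {f : (Fin n → ℂ) → ℂ} {z : Fin n → ℂ} {r : ℝ}
    (hf : DifferentiableOn ℂ f (Metric.ball z r)) :
    ‖f z‖ₑ * volume (Metric.ball (0 : Fin n → ℂ) r) ≤
      ∫⁻ x in Metric.ball z r, ‖f x‖ₑ := by
  set S := Metric.ball (0 : Fin n → ℂ) r with hS
  have hSm : MeasurableSet S := measurableSet_ball
  have hmem : ∀ (θ : ℝ) (w : Fin n → ℂ), w ∈ S → z + circleMap 0 1 θ • w ∈ Metric.ball z r := by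
    intro θ w hw
    have : ‖w‖ < r := by simpa [hS] using hw
    simpa [norm_smul] using this
  have hinner : ∀ θ : ℝ, ∫⁻ w in S, ‖f (z + circleMap 0 1 θ • w)‖ₑ =
      ∫⁻ x in Metric.ball z r, ‖f x‖ₑ := by
    intro θ
    have hmp : MeasurePreserving (fun w : Fin n → ℂ => z + circleMap 0 1 θ • w) volume volume :=
      (measurePreserving_add_left volume z).comp (measurePreserving_circleMap_smul θ)
    have hpre : (fun w : Fin n → ℂ => z + circleMap 0 1 θ • w) ⁻¹' (Metric.ball z r) = S := by
      ext w
      simp [hS, norm_smul]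
    have hmp' := hmp.restrict_preimage (s := Metric.ball z r) measurableSet_ball
    rw [hpre] at hmp'
    have hae : AEMeasurable (fun x => ‖f x‖ₑ) (volume.restrict (Metric.ball z r)) :=
      (hf.continuousOn.enorm).aemeasurable measurableSet_ball
    rw [← hmp'.map_eq] at hae ⊢
    rw [lintegral_map' hae hmp'.measurable.aemeasurable]
  have hswap : ∫⁻ w in S, ∫⁻ θ in Set.Ioc 0 (2 * Real.pi), ‖f (z + circleMap 0 1 θ • w)‖ₑ =
      ∫⁻ θ in Set.Ioc 0 (2 * Real.pi), ∫⁻ w in S, ‖f (z + circleMap 0 1 θ • w)‖ₑ := by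
    refine lintegral_lintegral_swap ?_
    rw [Measure.prod_restrict]
    refine ContinuousOn.aemeasurable ?_ (hSm.prod measurableSet_Ioc)
    refine ContinuousOn.enorm (hf.continuousOn.comp ?_ ?_)
    · refine Continuous.continuousOn ?_
      have : Continuous fun p : (Fin n → ℂ) × ℝ => circleMap 0 1 p.2 :=
        (continuous_circleMap 0 1).comp continuous_snd
      fun_prop
    · rintro ⟨w, θ⟩ ⟨hw, -⟩
      exact hmem θ w hw
  have hle : ENNReal.ofReal (2 * Real.pi) * ‖f z‖ₑ * volume S ≤
      ENNReal.ofReal (2 * Real.pi) * ∫⁻ x in Metric.ball z r, ‖f x‖ₑ := by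
    calc _ = ∫⁻ _ in S, ENNReal.ofReal (2 * Real.pi) * ‖f z‖ₑ := by
          rw [setLIntegral_const]
      _ ≤ ∫⁻ w in S, ∫⁻ θ in Set.Ioc 0 (2 * Real.pi), ‖f (z + circleMap 0 1 θ • w)‖ₑ :=
          setLIntegral_mono' hSm fun w hw => two_pi_mul_enorm_le_lintegral_circle hf hw
      _ = _ := by
          rw [hswap]
          simp_rw [hinner]
          rw [setLIntegral_const, Real.volume_Ioc, sub_zero, mul_comm]
  rw [mul_assoc] at hle
  exact (ENNReal.mul_le_mul_iff_right (by simp [Real.pi_pos]) ENNReal.ofReal_ne_top).1 hle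

/-- Point evaluations are locally uniformly bounded by the `L²(v_α)` norm. -/
lemma exists_local_bound {n : ℕ} {α : ℝ} (hc : 0 < weightConst n α * (n.factorial / Real.pi ^ n))
    {z₀ : Fin n → ℂ} (hz₀ : z₀ ∈ unitBall n) :
    ∃ r > 0, Metric.ball z₀ r ⊆ unitBall n ∧ ∃ C : ℝ, 0 < C ∧
      ∀ g : (Fin n → ℂ) → ℂ, DifferentiableOn ℂ g (unitBall n) →
        MemLp g 2 (weightedMeasure n α) → ∀ z ∈ Metric.ball z₀ r,
          ‖g z‖ ≤ C * (eLpNorm g 2 (weightedMeasure n α)).toReal := by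
  obtain ⟨R, hR, hRB⟩ := Metric.nhds_basis_closedBall.mem_iff.1 ((isOpen_unitBall n).mem_nhds hz₀)
  have hpos : ∀ z ∈ unitBall n, 0 < (1 - ∑ i, ‖z i‖ ^ 2) ^ α := fun z hz =>
    Real.rpow_pos_of_pos (sub_pos.2 hz) _
  have hcont : ContinuousOn (fun z : Fin n → ℂ => (1 - ∑ i, ‖z i‖ ^ 2) ^ α)
      (Metric.closedBall z₀ R) := by
    refine ContinuousOn.rpow_const (by fun_prop) fun z hz => Or.inl ?_
    exact (sub_pos.2 (hRB hz)).ne'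
  obtain ⟨y, hy, hymin⟩ := (isCompact_closedBall z₀ R).exists_isMinOn
    ⟨z₀, Metric.mem_closedBall_self hR.le⟩ hcont
  set d := (1 - ∑ i, ‖y i‖ ^ 2) ^ α with hd
  have hdpos : 0 < d := hpos y (hRB hy)
  set c := weightConst n α * (n.factorial / Real.pi ^ n) with hcdef
  set V := volume (Metric.ball (0 : Fin n → ℂ) (R / 2)) with hV
  have hV0 : V ≠ 0 := (Metric.measure_ball_pos volume _ (half_pos hR)).ne'
  have hVt : V ≠ ∞ := measure_ball_lt_top.ne
  set K : ℝ≥0∞ := (ENNReal.ofReal c * ENNReal.ofReal d * V)⁻¹ with hK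
  have hKprod0 : ENNReal.ofReal c * ENNReal.ofReal d * V ≠ 0 := by
    simp [hc, hdpos, hV0]
  have hKprodt : ENNReal.ofReal c * ENNReal.ofReal d * V ≠ ∞ :=
    ENNReal.mul_ne_top (ENNReal.mul_ne_top ENNReal.ofReal_ne_top ENNReal.ofReal_ne_top) hVt
  have hKt : K ≠ ∞ := ENNReal.inv_ne_top.2 hKprod0
  have hK0 : K ≠ 0 := ENNReal.inv_ne_zero.2 hKprodt
  refine ⟨R / 2, half_pos hR, ?_, Real.sqrt K.toReal,
    Real.sqrt_pos.2 (ENNReal.toReal_pos hK0 hKt), ?_⟩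
  · exact (Metric.ball_subset_ball (half_le_self hR.le)).trans
      (Metric.ball_subset_closedBall.trans hRB)
  intro g hg hgL z hz
  have hsub : Metric.ball z (R / 2) ⊆ Metric.closedBall z₀ R := by
    intro x hx
    have h1 : dist x z < R / 2 := hx
    have h2 : dist z z₀ < R / 2 := hz
    have h3 := dist_triangle x z z₀
    simp only [Metric.mem_closedBall]
    linarith
  have hg2 : DifferentiableOn ℂ (fun x => g x ^ 2) (Metric.ball z (R / 2)) :=
    (hg.mono (hsub.trans hRB)).pow 2
  have h1 := enorm_mul_volume_le_lintegral hg2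
  have h2 : ENNReal.ofReal c * (ENNReal.ofReal d * ∫⁻ x in Metric.ball z (R / 2), ‖g x ^ 2‖ₑ) ≤
      ∫⁻ x, ‖g x ^ 2‖ₑ ∂(weightedMeasure n α) := by
    rw [weightedMeasure, lintegral_smul_measure, smul_eq_mul]
    gcongr
    rw [← lintegral_const_mul' _ _ ENNReal.ofReal_ne_top]
    rw [lintegral_withDensity_eq_lintegral_mul_non_measurable₀]
    · calc _ ≤ ∫⁻ x in Metric.ball z (R / 2),
            ENNReal.ofReal ((1 - ∑ i, ‖x i‖ ^ 2) ^ α) * ‖g x ^ 2‖ₑ := by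
            refine setLIntegral_mono' measurableSet_ball fun x hx => ?_
            gcongr
            exact hymin (hsub hx)
        _ ≤ _ := lintegral_mono_set (hsub.trans hRB)
    · refine ENNReal.measurable_ofReal.comp_aemeasurable ?_
      refine Measurable.aemeasurable ?_
      fun_prop
    · exact ae_of_all _ fun x => ENNReal.ofReal_lt_top
  have h3 : ∫⁻ x, ‖g x ^ 2‖ₑ ∂(weightedMeasure n α) =
      eLpNorm g 2 (weightedMeasure n α) ^ 2 := by
    rw [eLpNorm_eq_lintegral_rpow_enorm_toReal (by norm_num) (by norm_num), ← ENNReal.rpow_natCast,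
      ← ENNReal.rpow_mul]
    simp [enorm_pow]
  have h4 : ‖g z‖ₑ ^ 2 ≤ K * eLpNorm g 2 (weightedMeasure n α) ^ 2 := by
    rw [hK, ← h3, mul_comm, ← div_eq_mul_inv,
      ENNReal.le_div_iff_mul_le (Or.inl hKprod0) (Or.inl hKprodt)]
    refine le_trans ?_ h2
    rw [enorm_pow] at h1
    calc ‖g z‖ₑ ^ 2 * (ENNReal.ofReal c * ENNReal.ofReal d * V)
        = ENNReal.ofReal c * (ENNReal.ofReal d * (‖g z‖ₑ ^ 2 * V)) := by ring
      _ ≤ _ := by gcongr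
  have h5 : ‖g z‖ ^ 2 ≤ K.toReal * (eLpNorm g 2 (weightedMeasure n α)).toReal ^ 2 := by
    have := ENNReal.toReal_mono (ENNReal.mul_ne_top hKt (ENNReal.pow_ne_top hgL.2.ne)) h4
    simpa [ENNReal.toReal_mul, ENNReal.toReal_pow] using this
  refine abs_le_of_sq_le_sq' ?_ (by positivity) |>.2
  rw [mul_pow, Real.sq_sqrt ENNReal.toReal_nonneg]
  exact h5

lemma isClosed_bergmanSpace (n : ℕ) (α : ℝ) :
    IsClosed (bergmanSpace n α : Set (Lp ℂ 2 (weightedMeasure n α))) := by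
  rcases le_or_gt (weightConst n α * (n.factorial / Real.pi ^ n)) 0 with hc | hc
  · have h0 : weightedMeasure n α = 0 := by
      rw [weightedMeasure, ENNReal.ofReal_of_nonpos hc, zero_smul]
    have : (bergmanSpace n α : Set (Lp ℂ 2 (weightedMeasure n α))) = Set.univ := by
      refine Set.eq_univ_of_forall fun f => ⟨0, differentiableOn_const 0, ?_⟩
      have hb : ae (weightedMeasure n α) = ⊥ := by rw [h0, ae_zero]
      change ∀ᶠ x in ae (weightedMeasure n α), _
      rw [hb]
      exact eventually_bot
    rw [this]
    exact isClosed_univ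
  refine IsSeqClosed.isClosed fun f f₀ hf hlim => ?_
  choose g hg hfg using hf
  have hgL : ∀ k, MemLp (g k) 2 (weightedMeasure n α) := fun k =>
    (memLp_congr_ae (hfg k)).1 (Lp.memLp (f k))
  have hnorm : ∀ k l, (eLpNorm (g k - g l) 2 (weightedMeasure n α)).toReal = ‖f k - f l‖ := by
    intro k l
    rw [Lp.norm_def]
    congr 1
    exact eLpNorm_congr_ae (((hfg k).symm.sub (hfg l).symm).trans (Lp.coeFn_sub _ _).symm)
  have hcau : ∀ z₀ ∈ unitBall n, ∃ r > 0, Metric.ball z₀ r ⊆ unitBall n ∧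
      UniformCauchySeqOn g atTop (Metric.ball z₀ r) := by
    intro z₀ hz₀
    obtain ⟨r, hr, hrB, C, hC, hb⟩ := exists_local_bound hc hz₀
    refine ⟨r, hr, hrB, Metric.uniformCauchySeqOn_iff.2 fun ε hε => ?_⟩
    obtain ⟨N, hN⟩ := Metric.cauchySeq_iff.1 hlim.cauchySeq (ε / C) (div_pos hε hC)
    refine ⟨N, fun k hk l hl z hz => ?_⟩
    have h := hb (g k - g l) ((hg k).sub (hg l)) ((hgL k).sub (hgL l)) z hz
    rw [hnorm, ← dist_eq_norm (f k)] at h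
    rw [dist_eq_norm]
    refine lt_of_le_of_lt h ?_
    have := hN k hk l hl
    rwa [lt_div_iff₀' hC] at this
  have hpt : ∀ z, ∃ y, z ∈ unitBall n → Tendsto (fun k => g k z) atTop (𝓝 y) := by
    intro z
    by_cases hz : z ∈ unitBall n
    · obtain ⟨r, hr, -, hu⟩ := hcau z hz
      obtain ⟨y, hy⟩ := cauchySeq_tendsto_of_complete (hu.cauchySeq (Metric.mem_ball_self hr))
      exact ⟨y, fun _ => hy⟩
    · exact ⟨0, fun h => absurd h hz⟩
  choose G hG using hpt
  refine ⟨G, ?_, ?_⟩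
  · intro z₀ hz₀
    obtain ⟨r, hr, hrB, hu⟩ := hcau z₀ hz₀
    have hr2 : 0 < r / 2 := half_pos hr
    have hsub : ∀ z ∈ Metric.ball z₀ (r / 2), Metric.ball z (r / 2) ⊆ Metric.ball z₀ r := by
      intro z hz x hx
      have h1 : dist x z < r / 2 := hx
      have h2 : dist z z₀ < r / 2 := hz
      have h3 := dist_triangle x z z₀
      simp only [Metric.mem_ball]
      linarith
    have hsub' : Metric.ball z₀ (r / 2) ⊆ unitBall n :=
      (Metric.ball_subset_ball (half_le_self hr.le)).trans hrB
    have hda : ∀ k, ∀ z ∈ unitBall n, DifferentiableAt ℂ (g k) z := fun k z hz =>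
      (hg k).differentiableAt ((isOpen_unitBall n).mem_nhds hz)
    have hud : UniformCauchySeqOn (fun k => fderiv ℂ (g k)) atTop (Metric.ball z₀ (r / 2)) := by
      refine Metric.uniformCauchySeqOn_iff.2 fun ε hε => ?_
      obtain ⟨N, hN⟩ := Metric.uniformCauchySeqOn_iff.1 hu (ε / 2 * (r / 2) / 2) (by positivity)
      refine ⟨N, fun k hk l hl z hz => ?_⟩
      have hle : ‖fderiv ℂ (g k - g l) z‖ ≤ (ε / 2 * (r / 2)) / (r / 2) := by
        refine Complex.norm_fderiv_le_div_of_mapsTo_ball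
          (((hg k).sub (hg l)).mono ((hsub z hz).trans hrB)) ?_ hr2
        intro x hx
        have hxz := hN k hk l hl x (hsub z hz hx)
        have hzz := hN k hk l hl z (hsub z hz (Metric.mem_ball_self hr2))
        rw [dist_eq_norm] at hxz hzz
        rw [Metric.mem_closedBall, dist_eq_norm]
        simp only [Pi.sub_apply]
        have := norm_sub_le (g k x - g l x) (g k z - g l z)
        linarith
      rw [dist_eq_norm, ← fderiv_sub (hda k z (hsub' hz)) (hda l z (hsub' hz))]
      rw [mul_div_cancel_right₀ _ hr2.ne'] at hle
      linarith
    have hpt' : ∀ z, ∃ L, z ∈ Metric.ball z₀ (r / 2) →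
        Tendsto (fun k => fderiv ℂ (g k) z) atTop (𝓝 L) := by
      intro z
      by_cases hz : z ∈ Metric.ball z₀ (r / 2)
      · obtain ⟨y, hy⟩ := cauchySeq_tendsto_of_complete (hud.cauchySeq hz)
        exact ⟨y, fun _ => hy⟩
      · exact ⟨0, fun h => absurd h hz⟩
    choose G' hG' using hpt'
    have hder := hasFDerivAt_of_tendstoUniformlyOn (f := g) (g := G) Metric.isOpen_ball
      (hud.tendstoUniformlyOn_of_tendsto hG')
      (fun k z hz => (hda k z (hsub' hz)).hasFDerivAt) (fun z hz => hG z (hsub' hz))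
      (Metric.mem_ball_self hr2)
    exact hder.differentiableAt.differentiableWithinAt
  · have hball : ∀ᵐ z ∂(weightedMeasure n α), z ∈ unitBall n := by
      rw [weightedMeasure]
      refine Measure.ae_smul_measure ?_ _
      exact (withDensity_absolutelyContinuous _ _).ae_le
        (ae_restrict_mem (isOpen_unitBall n).measurableSet)
    obtain ⟨ns, hns, hae⟩ := (tendstoInMeasure_of_tendsto_Lp hlim).exists_seq_tendsto_ae
    filter_upwards [hball, hae, ae_all_iff.2 hfg] with z hz h1 h2
    refine tendsto_nhds_unique h1 ?_
    have h3 := (hG z hz).comp hns.tendsto_atTop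
    refine h3.congr fun k => ?_
    simp [h2]

end Completeness

noncomputable instance instCompleteSpaceBergmanSpace (n : ℕ) (α : ℝ) :
    CompleteSpace (bergmanSpace n α) :=
  (isClosed_bergmanSpace n α).completeSpace_coe

/-- The action of `(σ, t) ∈ S_n ⋊ 𝕋ⁿ` on `ℂⁿ`: `(σ, t) z = (t₁ z_{σ(1)}, …, tₙ z_{σ(n)})`. -/
def permTorusAct {n : ℕ} (σ : Equiv.Perm (Fin n)) (t : Fin n → Circle) (z : Fin n → ℂ) :
    Fin n → ℂ :=
  fun i => (t i : ℂ) * z (σ i)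

/-- `a(hz) = a(z)` for almost every `z ∈ 𝔹ⁿ`, for every `h ∈ S_n ⋊ 𝕋ⁿ`. -/
def IsPermTorusInvariant {n : ℕ} (a : (Fin n → ℂ) → ℂ) : Prop :=
  ∀ (σ : Equiv.Perm (Fin n)) (t : Fin n → Circle),
    ∀ᵐ z ∂(volume.restrict (unitBall n)), a (permTorusAct σ t z) = a z

/-- `b` is a function of the radii `r = (|z₁|, …, |zₙ|)` that represents `a`: for almost every
`z ∈ 𝔹ⁿ`, `a(z) = b(|z₁|, …, |zₙ|)`. -/
def IsRadialProfile {n : ℕ} (a : (Fin n → ℂ) → ℂ) (b : (Fin n → ℝ) → ℂ) : Prop :=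
  Measurable b ∧ ∀ᵐ z ∂(volume.restrict (unitBall n)), a z = b (fun i => ‖z i‖)

/-- Symmetric separately radial symbols: `a ∈ L^∞(𝔹ⁿ)`, `a(z) = a(|z₁|, …, |zₙ|)` and
`a(σ(z)) = a(z)` for every permutation `σ`, for almost every `z ∈ 𝔹ⁿ`. -/
def IsSymmetricSeparatelyRadial {n : ℕ} (a : (Fin n → ℂ) → ℂ) : Prop :=
  MemLp a ∞ (volume.restrict (unitBall n)) ∧
    (∃ b, IsRadialProfile a b) ∧
    ∀ σ : Equiv.Perm (Fin n), ∀ᵐ z ∂(volume.restrict (unitBall n)), a (fun i => z (σ i)) = a z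

/-- `T` is the Toeplitz operator with symbol `a` on the weighted Bergman space:
`(T f)(z) = ∫_{𝔹ⁿ} a(w) f(w) (1 - z · w̄)^{-(n + α + 1)} dv_α(w)`. -/
def IsToeplitzOperator {n : ℕ} {α : ℝ} (a : (Fin n → ℂ) → ℂ)
    (T : bergmanSpace n α →L[ℂ] bergmanSpace n α) : Prop :=
  ∀ f : bergmanSpace n α,
    ((T f : Lp ℂ 2 (weightedMeasure n α)) : (Fin n → ℂ) → ℂ) =ᵐ[weightedMeasure n α]
      fun z => ∫ w, a w * (f : Lp ℂ 2 (weightedMeasure n α)) w *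
        (1 - ∑ i, z i * conj (w i)) ^ (-((n : ℂ) + (α : ℂ) + 1)) ∂(weightedMeasure n α)

/-- The (unital) C*-algebra of operators on a Hilbert space generated by a set of operators:
the norm closure of the *-algebra that it generates. -/
noncomputable def generatedCStarAlgebra {H : Type*} [NormedAddCommGroup H] [InnerProductSpace ℂ H]
    [CompleteSpace H] (S : Set (H →L[ℂ] H)) : StarSubalgebra ℂ (H →L[ℂ] H) :=
  (StarAlgebra.adjoin ℂ S).topologicalClosure

/-- The C*-algebra of operators on the weighted Bergman space generated by the Toeplitz operators
with symmetric separately radial symbols. -/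
noncomputable def symToeplitzAlgebra (n : ℕ) (α : ℝ) :
    StarSubalgebra ℂ (bergmanSpace n α →L[ℂ] bergmanSpace n α) :=
  generatedCStarAlgebra {T : bergmanSpace n α →L[ℂ] bergmanSpace n α |
    ∃ a, IsSymmetricSeparatelyRadial a ∧ IsToeplitzOperator a T}

/-- `m! = m₁! ⋯ mₙ!` for a multi-index `m`. -/
def multiFactorial {n : ℕ} (m : Fin n → ℕ) : ℕ := ∏ i, (m i).factorial

/-- The normalized monomial `e_m(z) = √(Γ(n + |m| + α + 1) / (m! Γ(n + α + 1))) z^m`. -/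
noncomputable def basisMonomial {n : ℕ} (α : ℝ) (m : Fin n → ℕ) (z : Fin n → ℂ) : ℂ :=
  (Real.sqrt (Real.Gamma (n + (∑ i, m i : ℕ) + α + 1) /
    (multiFactorial m * Real.Gamma (n + α + 1))) : ℂ) * ∏ i, z i ^ m i

/-- The set `𝓘` of decreasing multi-indices `ι₁ ≥ ι₂ ≥ ⋯ ≥ ιₙ ≥ 0`. -/
abbrev DecreasingIndex (n : ℕ) : Type := {ι : Fin n → ℕ // Antitone ι}

/-- The orbit `𝓘_ι = {(ι_{σ(1)}, …, ι_{σ(n)}) : σ ∈ S_n}`. -/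
def indexOrbit {n : ℕ} (ι : Fin n → ℕ) : Set (Fin n → ℕ) :=
  {m | ∃ σ : Equiv.Perm (Fin n), m = fun i => ι (σ i)}

/-- `ℓ²(ℤ₊ⁿ)`. -/
abbrev EllTwo (n : ℕ) : Type := lp (fun _ : Fin n → ℕ => ℂ) 2

/-- `ℓ²(𝓘_ι)`, as the subspace of `ℓ²(ℤ₊ⁿ)` of the sequences that vanish outside `𝓘_ι`. -/
def orbitEllTwo {n : ℕ} (ι : Fin n → ℕ) : Submodule ℂ (EllTwo n) where
  carrier := {x | ∀ m, m ∉ indexOrbit ι → x m = 0}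
  zero_mem' := fun _ _ => rfl
  add_mem' := by
    intro x y hx hy m hm
    simp [hx m hm, hy m hm]
  smul_mem' := by
    intro c x hx m hm
    simp [hx m hm]

/-- `τ(𝔹ⁿ)`, the set of `r ∈ ℝⁿ` with `rₖ ≥ 0` and `|r| < 1`. -/
def radialBall (n : ℕ) : Set (Fin n → ℝ) := {r | (∀ i, 0 ≤ r i) ∧ ∑ i, r i ^ 2 < 1}

/-- The integrand `b(r) r^{2m} (1 - |r|²)^α r₁ ⋯ rₙ` of the spectral function. -/
noncomputable def spectralIntegrand {n : ℕ} (α : ℝ) (b : (Fin n → ℝ) → ℂ) (m : Fin n → ℕ)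
    (r : Fin n → ℝ) : ℂ :=
  b r * (((∏ i, r i ^ (2 * m i)) * (1 - ∑ i, r i ^ 2) ^ α * ∏ i, r i : ℝ) : ℂ)

/-- The spectral function
`γ(m) = 2ⁿ Γ(n + |m| + α + 1) / (m! Γ(α + 1)) ∫_{τ(𝔹ⁿ)} b(r) r^{2m} (1 - |r|²)^α ∏ₖ rₖ drₖ`. -/
noncomputable def spectralFunction {n : ℕ} (α : ℝ) (b : (Fin n → ℝ) → ℂ) (m : Fin n → ℕ) : ℂ :=
  ((2 ^ n * Real.Gamma (n + (∑ i, m i : ℕ) + α + 1) /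
    (multiFactorial m * Real.Gamma (α + 1)) : ℝ) : ℂ) *
    ∫ r in radialBall n, spectralIntegrand α b m r

/-!
The monomials `e_m` form an orthonormal basis of the weighted Bergman space, and every Toeplitz
operator whose symbol is invariant under the torus is diagonal in this basis. Everything else
follows: diagonal operators commute with each other and with each other's adjoints, the eigenvalues
are the integrals `∫ a |e_m|² dv_α`, and these do not change when `m` is permuted because `a` and
`v_α` are invariant under permutations.

Orthogonality of the monomials with respect to `a dv_α` comes from rotating one coordinate
(`integral_mul_monomial_eq_zero`), and their norms from the Dirichlet integral
(`lintegral_prod_norm_pow_mul_truncPow`). For completeness, a holomorphic function is expanded in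
homogeneous polynomials (`exists_homogeneous_expansion`). The component of degree `k` is an average
of rotations of the function, so if the function is orthogonal to all monomials, each component is
orthogonal to itself and vanishes (`ae_eq_zero_of_integral_mul_conj_monomial_eq_zero`).

The operator `T_a` is given by an integral against `(1 - z · w̄)^{-(n + α + 1)}`. The binomial series
and the multinomial theorem expand this kernel as `∑ e_m(z) conj (e_m(w))`, which identifies the
integral operator with the orthogonal projection onto the Bergman space
(`coeFn_orthogonalProjectionOnto_bergmanSpace`); hence `T_a` is the compression of the multiplication
by `a`, and is bounded. Polar coordinates in each variable rewrite its diagonal entries as the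
spectral function (`integrableOn_spectralIntegrand_and_toeplitzEigenvalue_eq`).

That a symbol invariant under each rotation almost everywhere is almost everywhere a function of the
radii is seen by averaging it over the torus and applying Fubini's theorem
(`exists_isRadialProfile`).
-/

/-! ### Invariance of the weighted measure -/

/-- The density of `v_α` depends on `|z|` only, so `v_α` inherits every symmetry of Lebesgue measure
that preserves `|z|`. -/
lemma measurePreserving_weightedMeasure {n : ℕ} (α : ℝ) {Φ : (Fin n → ℂ) → (Fin n → ℂ)}
    (hΦ : MeasurePreserving Φ volume volume)
    (hn : ∀ z, ∑ i, ‖Φ z i‖ ^ 2 = ∑ i, ‖z i‖ ^ 2) :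
    MeasurePreserving Φ (weightedMeasure n α) (weightedMeasure n α) := by
  refine ⟨hΦ.measurable, ?_⟩
  have hpre : Φ ⁻¹' unitBall n = unitBall n := by
    ext z; simp [unitBall, hn]
  have hr := hΦ.restrict_preimage (isOpen_unitBall n).measurableSet
  rw [hpre] at hr
  rw [weightedMeasure, Measure.map_smul]
  congr 1
  ext s hs
  have hw : Measurable fun z : Fin n → ℂ => ENNReal.ofReal ((1 - ∑ i, ‖z i‖ ^ 2) ^ α) := by
    fun_prop
  rw [Measure.map_apply hΦ.measurable hs, withDensity_apply _ (hΦ.measurable hs),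
    withDensity_apply _ hs, ← lintegral_indicator (hΦ.measurable hs), ← lintegral_indicator hs,
    ← hr.lintegral_comp (hw.indicator hs)]
  congr 1
  ext z
  by_cases h : Φ z ∈ s <;> simp [h, hn]

lemma measurePreserving_circle_mul (t : Circle) :
    MeasurePreserving (fun x : ℂ => (t : ℂ) * x) volume volume := by
  have := (rotation t).measurePreserving
  have he : (fun x : ℂ => (t : ℂ) * x) = rotation t := by
    funext x; simp [rotation_apply]
  rw [he]; exact this

lemma measurePreserving_permTorusAct {n : ℕ} (σ : Equiv.Perm (Fin n)) (t : Fin n → Circle) :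
    MeasurePreserving (permTorusAct σ t) volume volume := by
  have h1 := volume_measurePreserving_piCongrLeft (fun _ : Fin n => ℂ) σ.symm
  have h2 := volume_preserving_pi (fun i => measurePreserving_circle_mul (t i))
  have h := h2.comp h1
  have he : permTorusAct σ t = (fun (a : Fin n → ℂ) i => (t i : ℂ) * a i) ∘
      (MeasurableEquiv.piCongrLeft (fun _ : Fin n => ℂ) σ.symm) := by
    funext z i
    have := MeasurableEquiv.piCongrLeft_apply_apply (β := fun _ : Fin n => ℂ) σ.symm z (σ i)
    simp only [Equiv.symm_apply_apply] at this
    simp [permTorusAct, this]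
  rw [he]
  exact h

lemma sum_norm_sq_permTorusAct {n : ℕ} (σ : Equiv.Perm (Fin n)) (t : Fin n → Circle)
    (z : Fin n → ℂ) : ∑ i, ‖permTorusAct σ t z i‖ ^ 2 = ∑ i, ‖z i‖ ^ 2 := by
  simp only [permTorusAct, norm_mul, Circle.norm_coe, one_mul]
  exact Equiv.sum_comp σ fun i => ‖z i‖ ^ 2

/-! ### Polar coordinates and the Dirichlet integral -/

lemma Complex.lintegral_comp_norm {f : ℝ → ℝ≥0∞} (hf : Measurable f) :
    ∫⁻ z : ℂ, f ‖z‖ = ∫⁻ r in Set.Ioi (0 : ℝ), ENNReal.ofReal (2 * Real.pi * r) * f r := by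
  rw [← Complex.lintegral_comp_polarCoord_symm]
  have h1 : ∫⁻ p in polarCoord.target, ENNReal.ofReal p.1 • f ‖Complex.polarCoord.symm p‖ =
      ∫⁻ p in Set.Ioi (0 : ℝ) ×ˢ Set.Ioo (-Real.pi) Real.pi, ENNReal.ofReal p.1 * f p.1 := by
    refine setLIntegral_congr_fun (by exact measurableSet_Ioi.prod measurableSet_Ioo) ?_
    rintro ⟨r, θ⟩ hp
    have : 0 < r := hp.1
    simp only [Complex.norm_polarCoord_symm, abs_of_pos this, smul_eq_mul]
  rw [h1, Measure.volume_eq_prod, ← Measure.prod_restrict, lintegral_prod _ (by fun_prop)]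
  refine lintegral_congr fun r => ?_
  simp only [lintegral_const, Measure.restrict_apply_univ, Real.volume_Ioo]
  rw [mul_comm, ← mul_assoc, ← ENNReal.ofReal_mul (by linarith [Real.pi_pos])]
  congr 2
  ring

lemma lintegral_comp_sq {f : ℝ → ℝ≥0∞} :
    ∫⁻ r in Set.Ioi (0 : ℝ), ENNReal.ofReal (2 * r) * f (r ^ 2) = ∫⁻ x in Set.Ioi (0 : ℝ), f x := by
  have himg : (fun r : ℝ => r ^ 2) '' Set.Ioi 0 = Set.Ioi 0 := by
    ext x
    constructor
    · rintro ⟨r, hr, rfl⟩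
      exact pow_pos (Set.mem_Ioi.1 hr) 2
    · intro hx
      exact ⟨√x, Real.sqrt_pos.2 hx, Real.sq_sqrt (le_of_lt hx)⟩
  have h := lintegral_image_eq_lintegral_deriv_mul_of_monotoneOn (s := Set.Ioi (0 : ℝ))
    (f := fun r : ℝ => r ^ 2) (f' := fun r => 2 * r) measurableSet_Ioi
    (fun x _ => by simpa using (hasDerivAt_pow 2 x).hasDerivWithinAt)
    (fun x hx y _ hxy => pow_le_pow_left₀ (le_of_lt hx) hxy 2) f
  rw [himg] at h
  exact h.symm

/-- The power `x₊^β` of the positive part, as an extended nonnegative real; it vanishes for `x ≤ 0`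
even when `β ≤ 0`, unlike `Real.rpow`. -/
noncomputable def truncPow (x β : ℝ) : ℝ≥0∞ := if 0 < x then ENNReal.ofReal (x ^ β) else 0

lemma measurable_truncPow (β : ℝ) : Measurable fun x => truncPow x β :=
  Measurable.ite measurableSet_Ioi (by fun_prop) measurable_const

open ProbabilityTheory in
/-- The beta integral `∫₀^s x^k (s - x)^β dx`, for all real `s`. -/
lemma lintegral_pow_mul_truncPow (k : ℕ) {β : ℝ} (hβ : -1 < β) (s : ℝ) :
    ∫⁻ x in Set.Ioi (0 : ℝ), ENNReal.ofReal (x ^ k) * truncPow (s - x) β =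
      ENNReal.ofReal (k.factorial * Real.Gamma (β + 1) / Real.Gamma (k + β + 2)) *
        truncPow s (k + β + 1) := by
  have hG : 0 < Real.Gamma (β + 1) := Real.Gamma_pos_of_pos (by linarith)
  have hG' : 0 < Real.Gamma (k + β + 2) := Real.Gamma_pos_of_pos (by
    have : (0 : ℝ) ≤ k := k.cast_nonneg
    linarith)
  rcases le_or_gt s 0 with hs | hs
  · rw [truncPow, if_neg hs.not_gt, mul_zero]
    refine (setLIntegral_congr_fun measurableSet_Ioi fun x hx => ?_).trans lintegral_zero
    have hx' : (0 : ℝ) < x := hx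
    simp [truncPow, if_neg (show ¬ x < s by linarith)]
  -- substitute `x = s u` and compare with the beta distribution
  have hsub : ∫⁻ x in Set.Ioi (0 : ℝ), ENNReal.ofReal (x ^ k) * truncPow (s - x) β =
      ∫⁻ u in Set.Ioi (0 : ℝ), ENNReal.ofReal s *
        (ENNReal.ofReal ((s * u) ^ k) * truncPow (s - s * u) β) := by
    have himg : (fun r : ℝ => s * r) '' Set.Ioi 0 = Set.Ioi 0 := by
      simp [Set.image_mul_left_Ioi hs]
    have h := lintegral_image_eq_lintegral_deriv_mul_of_monotoneOn (s := Set.Ioi (0 : ℝ))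
      (f := fun r : ℝ => s * r) (f' := fun _ => s) measurableSet_Ioi
      (fun x _ => by simpa using ((hasDerivAt_id x).const_mul s).hasDerivWithinAt)
      (fun x hx y _ hxy => mul_le_mul_of_nonneg_left hxy hs.le)
      (fun x => ENNReal.ofReal (x ^ k) * truncPow (s - x) β)
    rw [himg] at h
    exact h
  have hk1 : (0 : ℝ) < k + 1 := by positivity
  have hβ1 : (0 : ℝ) < β + 1 := by linarith
  have hB := beta_pos hk1 hβ1
  have hBeq : beta (k + 1) (β + 1) =
      k.factorial * Real.Gamma (β + 1) / Real.Gamma (k + β + 2) := by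
    rw [beta, Real.Gamma_nat_eq_factorial, show (k : ℝ) + 1 + (β + 1) = k + β + 2 by ring]
  have hpt : ∀ u ∈ Set.Ioi (0 : ℝ), ENNReal.ofReal s *
        (ENNReal.ofReal ((s * u) ^ k) * truncPow (s - s * u) β) =
      ENNReal.ofReal (beta (k + 1) (β + 1) * s ^ (k + β + 1)) * betaPDF (k + 1) (β + 1) u := by
    intro u hu
    have hu' : (0 : ℝ) < u := hu
    rcases le_or_gt 1 u with h1 | h1
    · have : ¬ (0 < s - s * u) := by nlinarith
      rw [betaPDF_eq_zero_of_one_le h1, truncPow, if_neg this]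
      simp
    · have h2 : 0 < s - s * u := by nlinarith
      rw [betaPDF_of_pos_lt_one hu' h1, truncPow, if_pos h2, ← ENNReal.ofReal_mul (by positivity),
        ← ENNReal.ofReal_mul hs.le, ← ENNReal.ofReal_mul (by positivity)]
      congr 1
      rw [show s - s * u = s * (1 - u) by ring, Real.mul_rpow hs.le (by linarith),
        show (k : ℝ) + β + 1 = k + β + 1 by rfl, Real.rpow_add hs, Real.rpow_add hs,
        Real.rpow_one, Real.rpow_natCast, add_sub_cancel_right, add_sub_cancel_right,
        Real.rpow_natCast, mul_pow]
      field_simp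
  rw [hsub, setLIntegral_congr_fun measurableSet_Ioi hpt, lintegral_const_mul' _ _
    ENNReal.ofReal_ne_top]
  have hfull : ∫⁻ u in Set.Ioi (0 : ℝ), betaPDF (k + 1) (β + 1) u = 1 := by
    rw [← lintegral_betaPDF_eq_one hk1 hβ1, ← lintegral_indicator measurableSet_Ioi]
    congr 1
    ext u
    by_cases hu : 0 < u
    · simp [hu]
    · simp [hu, betaPDF_eq_zero_of_nonpos (not_lt.1 hu)]
  rw [hfull, mul_one, truncPow, if_pos hs, hBeq, ENNReal.ofReal_mul (by positivity)]

lemma Complex.lintegral_norm_pow_mul_truncPow (k : ℕ) {β : ℝ} (hβ : -1 < β) (s : ℝ) :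
    ∫⁻ z : ℂ, ENNReal.ofReal (‖z‖ ^ (2 * k)) * truncPow (s - ‖z‖ ^ 2) β =
      ENNReal.ofReal (Real.pi * k.factorial * Real.Gamma (β + 1) / Real.Gamma (k + β + 2)) *
        truncPow s (k + β + 1) := by
  have hm := measurable_truncPow β
  rw [Complex.lintegral_comp_norm (f := fun r => ENNReal.ofReal (r ^ (2 * k)) *
    truncPow (s - r ^ 2) β) (by fun_prop)]
  have : ∀ r : ℝ, ENNReal.ofReal (2 * Real.pi * r) * (ENNReal.ofReal (r ^ (2 * k)) *
      truncPow (s - r ^ 2) β) = ENNReal.ofReal Real.pi * (ENNReal.ofReal (2 * r) *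
      (ENNReal.ofReal ((r ^ 2) ^ k) * truncPow (s - r ^ 2) β)) := by
    intro r
    rw [← mul_assoc (ENNReal.ofReal Real.pi), ← ENNReal.ofReal_mul Real.pi_pos.le, pow_mul]
    congr 2
    ring
  simp_rw [this]
  rw [lintegral_const_mul' _ _ ENNReal.ofReal_ne_top, lintegral_comp_sq
    (f := fun x => ENNReal.ofReal (x ^ k) * truncPow (s - x) β),
    lintegral_pow_mul_truncPow k hβ, ← mul_assoc, ← ENNReal.ofReal_mul Real.pi_pos.le]
  congr 2
  ring

/-- The Dirichlet integral over the ball of radius `√s` in `ℂⁿ`. Leaving `s` free makes the induction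
on `n` work: integrating out all coordinates but one leaves a one-dimensional integral of the same
kind, with a larger exponent. -/
lemma lintegral_prod_norm_pow_mul_truncPow {α : ℝ} (hα : -1 < α) :
    ∀ (n : ℕ) (m : Fin n → ℕ) (s : ℝ),
    ∫⁻ z : Fin n → ℂ, ENNReal.ofReal (∏ i, ‖z i‖ ^ (2 * m i)) *
        truncPow (s - ∑ i, ‖z i‖ ^ 2) α =
      ENNReal.ofReal (Real.pi ^ n * multiFactorial m * Real.Gamma (α + 1) /
        Real.Gamma (n + (∑ i, m i : ℕ) + α + 1)) *
        truncPow s (n + (∑ i, m i : ℕ) + α) := by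
  have hm := measurable_truncPow α
  intro n
  induction n with
  | zero =>
    intro m s
    have : Real.Gamma (α + 1) ≠ 0 := (Real.Gamma_pos_of_pos (by linarith)).ne'
    simp [multiFactorial, this, volume_pi]
  | succ n ih =>
    intro m s
    have hmp := (volume_preserving_piFinSuccAbove (fun _ : Fin (n + 1) => ℂ) 0).symm
    rw [← hmp.lintegral_comp_emb (MeasurableEquiv.measurableEmbedding _), Measure.volume_eq_prod,
      lintegral_prod _ (Measurable.aemeasurable (by fun_prop))]
    have hpt : ∀ (x : ℂ) (y : Fin n → ℂ),
        (MeasurableEquiv.piFinSuccAbove (fun _ : Fin (n + 1) => ℂ) 0).symm (x, y) =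
          Fin.cons x y := by
      intro x y; simp [MeasurableEquiv.piFinSuccAbove, Fin.consEquiv]
    have hinner : ∀ x : ℂ, ∫⁻ y : Fin n → ℂ,
        ENNReal.ofReal (∏ i, ‖(MeasurableEquiv.piFinSuccAbove (fun _ : Fin (n + 1) => ℂ) 0).symm
          (x, y) i‖ ^ (2 * m i)) * truncPow (s - ∑ i, ‖(MeasurableEquiv.piFinSuccAbove
          (fun _ : Fin (n + 1) => ℂ) 0).symm (x, y) i‖ ^ 2) α =
        ENNReal.ofReal (Real.pi ^ n * multiFactorial (fun i => m i.succ) * Real.Gamma (α + 1) /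
          Real.Gamma (n + (∑ i : Fin n, m i.succ : ℕ) + α + 1)) *
          (ENNReal.ofReal (‖x‖ ^ (2 * m 0)) *
            truncPow (s - ‖x‖ ^ 2) (n + (∑ i : Fin n, m i.succ : ℕ) + α)) := by
      intro x
      simp_rw [hpt, Fin.prod_univ_succ, Fin.sum_univ_succ, Fin.cons_zero, Fin.cons_succ,
        ENNReal.ofReal_mul (pow_nonneg (norm_nonneg x) _), ← sub_sub, mul_assoc]
      rw [lintegral_const_mul' _ _ ENNReal.ofReal_ne_top, ih (fun i => m i.succ)]
      rw [mul_left_comm]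
      simp only [add_assoc, mul_assoc]
    simp_rw [hinner]
    have hβ : -1 < (n : ℝ) + (∑ i : Fin n, m i.succ : ℕ) + α := by
      have h1 : (0 : ℝ) ≤ n := by positivity
      have h2 : (0 : ℝ) ≤ (∑ i : Fin n, m i.succ : ℕ) := by positivity
      linarith
    have hG : 0 < Real.Gamma ((n : ℝ) + (∑ i : Fin n, m i.succ : ℕ) + α + 1) :=
      Real.Gamma_pos_of_pos (by linarith)
    have hG1 : 0 < Real.Gamma (α + 1) := Real.Gamma_pos_of_pos (by linarith)
    rw [lintegral_const_mul' _ _ ENNReal.ofReal_ne_top,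
      Complex.lintegral_norm_pow_mul_truncPow (m 0) hβ, ← mul_assoc, ← ENNReal.ofReal_mul
      (by positivity)]
    have e1 : ((m 0 : ℕ) : ℝ) + ((n : ℝ) + (∑ i : Fin n, m i.succ : ℕ) + α) + 1 =
        ((n + 1 : ℕ) : ℝ) + (∑ i, m i : ℕ) + α := by
      rw [Fin.sum_univ_succ]; push_cast; ring
    have e2 : ((m 0 : ℕ) : ℝ) + ((n : ℝ) + (∑ i : Fin n, m i.succ : ℕ) + α) + 2 =
        ((n + 1 : ℕ) : ℝ) + (∑ i, m i : ℕ) + α + 1 := by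
      rw [← e1]; ring
    rw [e1, e2]
    congr 2
    rw [multiFactorial, multiFactorial, Fin.prod_univ_succ]
    have hG' := hG.ne'
    generalize Real.Gamma ((n : ℝ) + (∑ i : Fin n, m i.succ : ℕ) + α + 1) = G at hG'
    push_cast
    rw [pow_succ]
    field_simp

lemma lintegral_fin_prod_eq_prod : ∀ (n : ℕ) (f : Fin n → ℝ → ℝ≥0∞), (∀ i, Measurable (f i)) →
    ∫⁻ r : Fin n → ℝ, ∏ i, f i (r i) = ∏ i, ∫⁻ x, f i x := by
  intro n
  induction n with
  | zero => intro f _; simp [volume_pi]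
  | succ n ih =>
    intro f hf
    have hmp := (volume_preserving_piFinSuccAbove (fun _ : Fin (n + 1) => ℝ) 0).symm
    rw [← hmp.lintegral_comp_emb (MeasurableEquiv.measurableEmbedding _), Measure.volume_eq_prod,
      Fin.prod_univ_succ, ← ih (fun i => f i.succ) fun i => hf _,
      ← lintegral_prod_mul (hf 0).aemeasurable (Measurable.aemeasurable (by fun_prop))]
    refine lintegral_congr fun p => ?_
    rw [Fin.prod_univ_succ]
    simp [MeasurableEquiv.piFinSuccAbove]

lemma measurableSet_forall_pos (n : ℕ) : MeasurableSet {r : Fin n → ℝ | ∀ i, 0 < r i} := by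
  have : {r : Fin n → ℝ | ∀ i, 0 < r i} = Set.univ.pi fun _ => Set.Ioi 0 := by ext; simp
  rw [this]
  exact MeasurableSet.univ_pi fun _ => measurableSet_Ioi

/-- The image of Lebesgue measure on `ℂⁿ` under `z ↦ (|z₁|, …, |zₙ|)`. -/
lemma map_norm_volume (n : ℕ) :
    (volume : Measure (Fin n → ℂ)).map (fun z i => ‖z i‖) =
      (volume.restrict {r : Fin n → ℝ | ∀ i, 0 < r i}).withDensity
        (fun r => ∏ i, ENNReal.ofReal (2 * Real.pi * r i)) := by
  set ν : Measure ℝ := (volume.restrict (Set.Ioi (0 : ℝ))).withDensity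
    (fun r => ENNReal.ofReal (2 * Real.pi * r)) with hν
  have hν1 : ∀ s, MeasurableSet s → volume ((fun z : ℂ => ‖z‖) ⁻¹' s) = ν s := by
    intro s hs
    rw [hν, withDensity_apply _ hs, ← lintegral_indicator hs,
      ← lintegral_indicator_one (measurable_norm hs)]
    refine (Complex.lintegral_comp_norm (f := s.indicator 1)
      (measurable_one.indicator hs)).trans ?_
    refine lintegral_congr fun r => ?_
    by_cases hr : r ∈ s <;> simp [hr]
  have hpos := measurableSet_forall_pos n
  have hm : Measurable fun (z : Fin n → ℂ) i => ‖z i‖ := by fun_prop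
  trans Measure.pi fun _ : Fin n => ν
  · refine (Measure.pi_eq fun s hs => ?_).symm
    rw [Measure.map_apply hm (MeasurableSet.univ_pi hs)]
    have : (fun (z : Fin n → ℂ) i => ‖z i‖) ⁻¹' Set.univ.pi s =
        Set.univ.pi fun i => (fun z : ℂ => ‖z‖) ⁻¹' s i := by ext; simp
    rw [this, volume_pi_pi]
    exact Finset.prod_congr rfl fun i _ => hν1 _ (hs i)
  · refine Measure.pi_eq fun s hs => ?_
    rw [withDensity_apply _ (MeasurableSet.univ_pi hs), Measure.restrict_restrict
      (MeasurableSet.univ_pi hs), ← lintegral_indicator ((MeasurableSet.univ_pi hs).inter hpos)]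
    have h := lintegral_fin_prod_eq_prod n
      (fun i => (s i ∩ Set.Ioi 0).indicator fun r => ENNReal.ofReal (2 * Real.pi * r))
      (fun i => Measurable.indicator (by fun_prop) ((hs i).inter measurableSet_Ioi))
    have e : ∀ i, ∫⁻ x, (s i ∩ Set.Ioi 0).indicator (fun r => ENNReal.ofReal (2 * Real.pi * r)) x
        = ν (s i) := by
      intro i
      rw [hν, withDensity_apply _ (hs i), Measure.restrict_restrict (hs i),
        lintegral_indicator ((hs i).inter measurableSet_Ioi)]
    simp_rw [e] at h
    rw [← h]
    refine lintegral_congr fun r => ?_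
    by_cases hr : r ∈ Set.univ.pi s ∩ {r | ∀ i, 0 < r i}
    · rw [Set.indicator_of_mem hr]
      refine Finset.prod_congr rfl fun i _ => ?_
      rw [Set.indicator_of_mem]
      exact ⟨hr.1 i trivial, hr.2 i⟩
    · rw [Set.indicator_of_notMem hr]
      symm
      have : ∃ i, r i ∉ s i ∩ Set.Ioi 0 := by
        by_contra! hc
        exact hr ⟨fun i _ => (hc i).1, fun i => (hc i).2⟩
      obtain ⟨i, hi⟩ := this
      exact Finset.prod_eq_zero (Finset.mem_univ i) (Set.indicator_of_notMem hi _)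

/-! ### Moments of the weighted measure -/

lemma gamma_add_one_pos (n : ℕ) {α : ℝ} (hα : -1 < α) : 0 < Real.Gamma (n + α + 1) := by
  refine Real.Gamma_pos_of_pos ?_
  have : (0 : ℝ) ≤ n := n.cast_nonneg
  linarith

lemma weightConst_pos (n : ℕ) {α : ℝ} (hα : -1 < α) : 0 < weightConst n α := by
  have h1 := Real.Gamma_pos_of_pos (show 0 < α + 1 by linarith)
  have h2 := gamma_add_one_pos n hα
  unfold weightConst
  positivity

lemma lintegral_weightedMeasure {n : ℕ} {α : ℝ} (f : (Fin n → ℂ) → ℝ≥0∞) :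
    ∫⁻ z, f z ∂(weightedMeasure n α) =
      ENNReal.ofReal (weightConst n α * (n.factorial / Real.pi ^ n)) *
        ∫⁻ z, truncPow (1 - ∑ i, ‖z i‖ ^ 2) α * f z := by
  rw [weightedMeasure, lintegral_smul_measure, smul_eq_mul,
    lintegral_withDensity_eq_lintegral_mul_non_measurable₀,
    ← lintegral_indicator (isOpen_unitBall n).measurableSet]
  · congr 1
    refine lintegral_congr fun z => ?_
    by_cases hz : z ∈ unitBall n
    · have : 0 < 1 - ∑ i, ‖z i‖ ^ 2 := sub_pos.2 hz
      simp only [Set.indicator_of_mem hz, truncPow, if_pos this, Pi.mul_apply]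
    · have : ¬ 0 < 1 - ∑ i, ‖z i‖ ^ 2 := fun h => hz (sub_pos.1 h)
      simp only [Set.indicator_of_notMem hz, truncPow, if_neg this, zero_mul]
  · exact Measurable.aemeasurable (by fun_prop)
  · exact ae_of_all _ fun x => ENNReal.ofReal_lt_top

lemma lintegral_prod_norm_pow_weightedMeasure {n : ℕ} {α : ℝ} (hα : -1 < α) (m : Fin n → ℕ) :
    ∫⁻ z, ENNReal.ofReal (∏ i, ‖z i‖ ^ (2 * m i)) ∂(weightedMeasure n α) =
      ENNReal.ofReal (multiFactorial m * Real.Gamma (n + α + 1) /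
        Real.Gamma (n + (∑ i, m i : ℕ) + α + 1)) := by
  have h1 := Real.Gamma_pos_of_pos (show 0 < α + 1 by linarith)
  rw [lintegral_weightedMeasure]
  simp_rw [mul_comm (truncPow _ _)]
  rw [lintegral_prod_norm_pow_mul_truncPow hα, truncPow, if_pos one_pos, Real.one_rpow,
    ENNReal.ofReal_one, mul_one, ← ENNReal.ofReal_mul]
  · congr 1
    unfold weightConst
    have hpi := Real.pi_pos
    have hf : (0 : ℝ) < n.factorial := by exact_mod_cast n.factorial_pos
    field_simp
  · have := weightConst_pos n hα
    positivity

lemma isProbabilityMeasure_weightedMeasure (n : ℕ) {α : ℝ} (hα : -1 < α) :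
    IsProbabilityMeasure (weightedMeasure n α) := by
  constructor
  have h := lintegral_prod_norm_pow_weightedMeasure hα (0 : Fin n → ℕ)
  have h2 := gamma_add_one_pos n hα
  simpa [multiFactorial, h2.ne'] using h

lemma weightedMeasure_absolutelyContinuous (n : ℕ) (α : ℝ) :
    weightedMeasure n α ≪ volume.restrict (unitBall n) :=
  (withDensity_absolutelyContinuous _ _).smul_left _

lemma ae_weightedMeasure_mem_unitBall (n : ℕ) (α : ℝ) :
    ∀ᵐ z ∂(weightedMeasure n α), z ∈ unitBall n :=
  (weightedMeasure_absolutelyContinuous n α).ae_le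
    (ae_restrict_mem (isOpen_unitBall n).measurableSet)

/-! ### Homogeneous expansion of holomorphic functions on the ball -/

/-- Directional derivatives of a holomorphic function of several variables are holomorphic: they are
given by a Cauchy integral over a small circle in the direction `v`, which can be differentiated
under the integral sign. -/
lemma differentiableOn_fderiv_apply {n : ℕ} {U : Set (Fin n → ℂ)} (hU : IsOpen U)
    {f : (Fin n → ℂ) → ℂ} (hf : DifferentiableOn ℂ f U) (v : Fin n → ℂ) :
    DifferentiableOn ℂ (fun z => fderiv ℂ f z v) U := by
  intro z₀ hz₀
  obtain ⟨r, hr, hrU⟩ := Metric.nhds_basis_closedBall.mem_iff.1 (hU.mem_nhds hz₀)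
  set R := r / 3 with hR
  have hR0 : 0 < R := by positivity
  obtain ⟨M, hM⟩ := (isCompact_closedBall z₀ r).exists_bound_of_continuousOn
    (hf.continuousOn.mono hrU)
  have hda : ∀ z ∈ Metric.closedBall z₀ r, DifferentiableAt ℂ f z := fun z hz =>
    hf.differentiableAt (hU.mem_nhds (hrU hz))
  set ε := R / (‖v‖ + 1) with hε
  have hε0 : 0 < ε := by positivity
  have hεv : ε * ‖v‖ ≤ R := by
    rw [hε, div_mul_eq_mul_div, div_le_iff₀ (by positivity)]
    nlinarith [norm_nonneg v]
  -- the points `z + ζ v` stay at distance at least `R` from the boundary of the large ball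
  have hmem : ∀ z ∈ Metric.ball z₀ R, ∀ ζ : ℂ, ‖ζ‖ ≤ ε →
      z + ζ • v ∈ Metric.closedBall z₀ (2 * R) := by
    intro z hz ζ hζ
    have h1 : dist z z₀ < R := hz
    have h2 : dist (z + ζ • v) z ≤ R := by
      rw [dist_self_add_left, norm_smul]
      exact (mul_le_mul_of_nonneg_right hζ (norm_nonneg v)).trans hεv
    have h3 := dist_triangle (z + ζ • v) z z₀
    simp only [Metric.mem_closedBall]
    linarith
  have h2r : Metric.closedBall z₀ (2 * R) ⊆ Metric.closedBall z₀ r :=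
    Metric.closedBall_subset_closedBall (by rw [hR]; linarith)
  have hbound : ∀ z ∈ Metric.closedBall z₀ (2 * R), ‖fderiv ℂ f z‖ ≤ (2 * M) / R := by
    intro z hz
    have hsub : Metric.ball z R ⊆ Metric.closedBall z₀ r := by
      intro x hx
      have h1 : dist x z < R := hx
      have h2 : dist z z₀ ≤ 2 * R := hz
      have h3 := dist_triangle x z z₀
      simp only [Metric.mem_closedBall]
      linarith
    refine Complex.norm_fderiv_le_div_of_mapsTo_ball (hf.mono (hsub.trans hrU)) ?_ hR0
    intro x hx
    rw [Metric.mem_closedBall, dist_eq_norm]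
    have h1 := hM x (hsub hx)
    have h2 := hM z (h2r hz)
    have h3 := norm_sub_le (f x) (f z)
    linarith
  set c : ℝ → ℂ := fun θ => deriv (circleMap 0 ε) θ * (1 / (circleMap 0 ε θ) ^ 2) with hc
  have hcm0 : ∀ θ, circleMap 0 ε θ ≠ 0 := fun θ => circleMap_ne_center hε0.ne'
  have hcm : ∀ θ, ‖circleMap 0 ε θ‖ = ε := fun θ => by simp [abs_of_pos hε0]
  have hccont : Continuous c := by
    simp only [hc, deriv_circleMap]
    have := continuous_circleMap 0 ε
    refine Continuous.mul (by fun_prop) (Continuous.div (by fun_prop) (by fun_prop) ?_)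
    exact fun θ => pow_ne_zero 2 (hcm0 θ)
  have hcnorm : ∀ θ, ‖c θ‖ = 1 / ε := by
    intro θ
    simp only [hc, deriv_circleMap, norm_mul, norm_div, norm_pow, hcm, norm_one, Complex.norm_I]
    field_simp
  have hkey : HasFDerivAt (fun z => ∫ θ in Set.Ioc 0 (2 * Real.pi),
      c θ • f (z + circleMap 0 ε θ • v))
      (∫ θ in Set.Ioc 0 (2 * Real.pi), c θ • fderiv ℂ f (z₀ + circleMap 0 ε θ • v)) z₀ := by
    have hFcont : ∀ z ∈ Metric.ball z₀ R,
        Continuous fun θ => c θ • f (z + circleMap 0 ε θ • v) := by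
      intro z hz
      refine hccont.smul ?_
      refine (hf.continuousOn.mono hrU).comp_continuous ?_ fun θ =>
        h2r (hmem z hz _ (hcm θ).le)
      have := continuous_circleMap 0 ε
      fun_prop
    refine hasFDerivAt_integral_of_dominated_of_fderiv_le (𝕜 := ℂ)
      (F' := fun z θ => c θ • fderiv ℂ f (z + circleMap 0 ε θ • v))
      (bound := fun _ => 1 / ε * (2 * M / R)) (Metric.ball_mem_nhds z₀ hR0) ?_ ?_ ?_ ?_ ?_ ?_
    · filter_upwards [Metric.ball_mem_nhds z₀ hR0] with z hz
      exact (hFcont z hz).aestronglyMeasurable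
    · exact (hFcont z₀ (Metric.mem_ball_self hR0)).integrableOn_Icc.mono_set
        Set.Ioc_subset_Icc_self
    · have h1 : Measurable fun θ => fderiv ℂ f (z₀ + circleMap 0 ε θ • v) := by
        refine (measurable_fderiv ℂ f).comp (Continuous.measurable ?_)
        have := continuous_circleMap 0 ε
        fun_prop
      exact (hccont.measurable.smul h1).aestronglyMeasurable
    · refine ae_of_all _ fun θ z hz => ?_
      rw [norm_smul, hcnorm]
      exact mul_le_mul_of_nonneg_left (hbound _ (hmem z hz _ (hcm θ).le)) (by positivity)
    · exact integrable_const _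
    · refine ae_of_all _ fun θ z hz => ?_
      have h1 := (hda _ (h2r (hmem z hz _ (hcm θ).le))).hasFDerivAt
      have h2 : HasFDerivAt (fun x => x + circleMap 0 ε θ • v) (ContinuousLinearMap.id ℂ _) z :=
        (hasFDerivAt_id z).add_const _
      exact (h1.comp z h2).const_smul (c θ)
  have heq : ∀ z ∈ Metric.ball z₀ R, fderiv ℂ f z v = (2 * Real.pi * Complex.I)⁻¹ •
      ∫ θ in Set.Ioc 0 (2 * Real.pi), c θ • f (z + circleMap 0 ε θ • v) := by
    intro z hz
    have hd : DifferentiableOn ℂ (fun ζ : ℂ => f (z + ζ • v)) (Metric.closedBall 0 ε) := by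
      intro ζ hζ
      refine DifferentiableAt.differentiableWithinAt ?_
      have := hda _ (h2r (hmem z hz ζ (by simpa using hζ)))
      exact this.comp (g := f) ζ (by fun_prop)
    have h := hd.deriv_eq_smul_circleIntegral hε0
    have hder : deriv (fun ζ : ℂ => f (z + ζ • v)) 0 = fderiv ℂ f z v := by
      have h1 : HasFDerivAt f (fderiv ℂ f z) (z + (0 : ℂ) • v) := by
        rw [zero_smul, add_zero]
        exact (hda z (h2r (by simpa using hmem z hz 0 (by simpa using hε0.le)))).hasFDerivAt
      have h2 : HasDerivAt (fun ζ : ℂ => z + ζ • v) v 0 := by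
        simpa using ((hasDerivAt_id (0 : ℂ)).smul_const v).const_add z
      exact (h1.comp_hasDerivAt 0 h2).deriv
    rw [hder] at h
    rw [eq_inv_smul_iff₀ Complex.two_pi_I_ne_zero, ← h, circleIntegral,
      intervalIntegral.integral_of_le Real.two_pi_pos.le]
    simp only [hc, smul_smul, sub_zero]
  refine DifferentiableAt.differentiableWithinAt ?_
  refine (hkey.differentiableAt.const_smul (2 * Real.pi * Complex.I)⁻¹).congr_of_eventuallyEq ?_
  filter_upwards [Metric.ball_mem_nhds z₀ hR0] with z hz
  exact heq z hz

lemma smul_mem_unitBall_nhds {n : ℕ} (w : Fin n → ℂ) :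
    ∀ᶠ ζ : ℂ in 𝓝 0, ζ • w ∈ unitBall n := by
  have hc : Continuous fun ζ : ℂ => ζ • w := by fun_prop
  refine hc.continuousAt.eventually_mem ((isOpen_unitBall n).mem_nhds ?_)
  simp [unitBall]

/-- The derivatives at `0` of the restriction of `g` to a complex line through `0` are homogeneous
polynomials in the direction of the line. -/
lemma exists_isHomogeneous_iteratedDeriv_eq {n : ℕ} (k : ℕ) :
    ∀ g : (Fin n → ℂ) → ℂ, DifferentiableOn ℂ g (unitBall n) →
      ∃ p : MvPolynomial (Fin n) ℂ, p.IsHomogeneous k ∧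
        ∀ w, iteratedDeriv k (fun ζ : ℂ => g (ζ • w)) 0 = MvPolynomial.eval w p := by
  induction k with
  | zero =>
    intro g _
    refine ⟨MvPolynomial.C (g 0), MvPolynomial.isHomogeneous_C _ _, fun w => ?_⟩
    simp
  | succ k ih =>
    intro g hg
    have hgi : ∀ i, DifferentiableOn ℂ (fun z => fderiv ℂ g z (Pi.single i 1)) (unitBall n) :=
      fun i => differentiableOn_fderiv_apply (isOpen_unitBall n) hg _
    choose p hp hpe using fun i => ih _ (hgi i)
    refine ⟨∑ i, MvPolynomial.X i * p i, ?_, fun w => ?_⟩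
    · refine MvPolynomial.IsHomogeneous.sum _ _ _ fun i _ => ?_
      rw [add_comm]
      exact (MvPolynomial.isHomogeneous_X _ i).mul (hp i)
    · rw [iteratedDeriv_succ']
      have hev : deriv (fun ζ : ℂ => g (ζ • w)) =ᶠ[𝓝 0]
          fun ζ => ∑ i, w i * fderiv ℂ g (ζ • w) (Pi.single i 1) := by
        filter_upwards [smul_mem_unitBall_nhds w] with ζ hζ
        have h1 := (hg.differentiableAt ((isOpen_unitBall n).mem_nhds hζ)).hasFDerivAt
        have h2 : HasDerivAt (fun ζ : ℂ => ζ • w) w ζ := by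
          simpa using (hasDerivAt_id ζ).smul_const w
        have h3 : deriv (fun ζ : ℂ => g (ζ • w)) ζ = fderiv ℂ g (ζ • w) w :=
          (h1.comp_hasDerivAt ζ h2).deriv
        rw [h3]
        generalize fderiv ℂ g (ζ • w) = L
        conv_lhs => rw [← Finset.univ_sum_single w, map_sum]
        refine Finset.sum_congr rfl fun i _ => ?_
        rw [show Pi.single i (w i) = w i • (Pi.single i 1 : Fin n → ℂ) by
          rw [← Pi.single_smul, smul_eq_mul, mul_one], map_smul, smul_eq_mul]
      rw [hev.iteratedDeriv_eq]
      have hcd : ∀ i, ContDiffAt ℂ k (fun ζ : ℂ => fderiv ℂ g (ζ • w) (Pi.single i 1)) 0 := by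
        intro i
        have hopen : IsOpen {ζ : ℂ | ζ • w ∈ unitBall n} :=
          (isOpen_unitBall n).preimage (by fun_prop)
        have hd : DifferentiableOn ℂ (fun ζ : ℂ => fderiv ℂ g (ζ • w) (Pi.single i 1))
            {ζ : ℂ | ζ • w ∈ unitBall n} :=
          (hgi i).comp (by fun_prop) fun ζ hζ => hζ
        exact (hd.contDiffOn hopen).contDiffAt
          (hopen.mem_nhds (smul_mem_unitBall_nhds w).self_of_nhds)
      rw [iteratedDeriv_fun_sum fun i _ => (contDiffAt_const.mul (hcd i))]
      simp only [map_sum, map_mul, MvPolynomial.eval_X]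
      refine Finset.sum_congr rfl fun i _ => ?_
      rw [← hpe i w, iteratedDeriv_const_mul_field]

/-- The restriction of `g` to the line through `w` is holomorphic beyond the closed unit disc. -/
lemma exists_differentiableOn_slice {n : ℕ} {g : (Fin n → ℂ) → ℂ}
    (hg : DifferentiableOn ℂ g (unitBall n)) {w : Fin n → ℂ} (hw : w ∈ unitBall n) :
    ∃ r : ℝ, 1 < r ∧ DifferentiableOn ℂ (fun ζ : ℂ => g (ζ • w)) (Metric.ball 0 r) := by
  set s := ∑ i, ‖w i‖ ^ 2 with hs
  have hs1 : s < 1 := hw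
  have hs0 : 0 ≤ s := by positivity
  refine ⟨2 / (1 + s), ?_, ?_⟩
  · rw [lt_div_iff₀ (by positivity)]; linarith
  · refine hg.comp (by fun_prop) fun ζ hζ => ?_
    have hζ' : ‖ζ‖ < 2 / (1 + s) := by simpa using hζ
    have h1 : ‖ζ‖ ^ 2 ≤ (2 / (1 + s)) ^ 2 := pow_le_pow_left₀ (norm_nonneg _) hζ'.le 2
    have h2 : (2 / (1 + s)) ^ 2 * s < 1 := by
      rw [div_pow, div_mul_eq_mul_div, div_lt_one (by positivity)]
      nlinarith [sq_pos_of_pos (sub_pos.2 hs1)]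
    simp only [unitBall, Set.mem_ofPred_eq, Pi.smul_apply, smul_eq_mul, norm_mul, mul_pow]
    rw [← Finset.mul_sum]
    exact lt_of_le_of_lt (mul_le_mul_of_nonneg_right h1 hs0) h2

/-- A holomorphic function on the ball is the sum of its homogeneous components, which are recovered
by Fourier analysis on the circles `θ ↦ e^{iθ} w`. -/
lemma exists_homogeneous_expansion {n : ℕ} {g : (Fin n → ℂ) → ℂ}
    (hg : DifferentiableOn ℂ g (unitBall n)) :
    ∃ p : ℕ → MvPolynomial (Fin n) ℂ, (∀ k, (p k).IsHomogeneous k) ∧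
      ∀ w ∈ unitBall n, HasSum (fun k => MvPolynomial.eval w (p k)) (g w) ∧
        ∀ k, (2 * Real.pi : ℂ) * MvPolynomial.eval w (p k) =
          ∫ θ in Set.Ioc 0 (2 * Real.pi), (circleMap 0 1 θ ^ k)⁻¹ * g (circleMap 0 1 θ • w) := by
  choose p hp hpe using fun k => exists_isHomogeneous_iteratedDeriv_eq k g hg
  refine ⟨fun k => MvPolynomial.C ((k.factorial : ℂ)⁻¹) * p k, fun k => ?_, fun w hw => ⟨?_, ?_⟩⟩
  · simpa using (MvPolynomial.isHomogeneous_C (Fin n) ((k.factorial : ℂ)⁻¹)).mul (hp k)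
  · obtain ⟨r, hr, hd⟩ := exists_differentiableOn_slice hg hw
    have h := Complex.hasSum_taylorSeries_on_ball hd (z := 1) (by simpa using hr)
    simpa [hpe] using h
  · intro k
    obtain ⟨r, hr, hd⟩ := exists_differentiableOn_slice hg hw
    have h := (hd.mono (Metric.closedBall_subset_ball hr)).circleIntegral_one_div_sub_center_pow_smul
      one_pos k
    rw [hpe, circleIntegral, intervalIntegral.integral_of_le Real.two_pi_pos.le] at h
    have h2 : ∀ θ : ℝ, deriv (circleMap 0 1) θ • (1 / (circleMap 0 1 θ - 0) ^ (k + 1)) •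
        g (circleMap 0 1 θ • w) = Complex.I *
          ((circleMap 0 1 θ ^ k)⁻¹ * g (circleMap 0 1 θ • w)) := by
      intro θ
      have : circleMap 0 1 θ ≠ 0 := circleMap_ne_center one_ne_zero
      simp only [deriv_circleMap, smul_eq_mul, sub_zero, pow_succ]
      field_simp
    simp_rw [h2] at h
    rw [integral_const_mul] at h
    have hk : (k.factorial : ℂ) ≠ 0 := by exact_mod_cast k.factorial_ne_zero
    refine mul_left_cancel₀ Complex.I_ne_zero (Eq.trans ?_ h.symm)
    simp only [map_mul, MvPolynomial.eval_C, smul_eq_mul]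
    field_simp

/-! ### The monomials as an orthonormal family -/

lemma norm_apply_le_one_of_mem_unitBall {n : ℕ} {z : Fin n → ℂ} (hz : z ∈ unitBall n) (i : Fin n) :
    ‖z i‖ ≤ 1 := by
  have h1 : ‖z i‖ ^ 2 ≤ ∑ j, ‖z j‖ ^ 2 :=
    Finset.single_le_sum (f := fun j => ‖z j‖ ^ 2) (fun j _ => by positivity) (Finset.mem_univ i)
  have h2 : ∑ j, ‖z j‖ ^ 2 < 1 := hz
  nlinarith [norm_nonneg (z i)]

lemma exists_bound_on_unitBall {n : ℕ} {h : (Fin n → ℂ) → ℂ} (hh : Continuous h) :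
    ∃ C : ℝ, ∀ z ∈ unitBall n, ‖h z‖ ≤ C := by
  obtain ⟨C, hC⟩ := (isCompact_closedBall (0 : Fin n → ℂ) 1).exists_bound_of_continuousOn
    hh.continuousOn
  refine ⟨C, fun z hz => hC z ?_⟩
  rw [mem_closedBall_zero_iff, pi_norm_le_iff_of_nonneg zero_le_one]
  exact norm_apply_le_one_of_mem_unitBall hz

lemma memLp_of_continuous {n : ℕ} {α : ℝ} (hα : -1 < α) {h : (Fin n → ℂ) → ℂ} (hh : Continuous h)
    (p : ℝ≥0∞) : MemLp h p (weightedMeasure n α) := by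
  have := isProbabilityMeasure_weightedMeasure n hα
  obtain ⟨C, hC⟩ := exists_bound_on_unitBall hh
  exact MemLp.of_bound hh.aestronglyMeasurable C
    ((ae_weightedMeasure_mem_unitBall n α).mono hC)

lemma measurableEmbedding_permTorusAct {n : ℕ} (σ : Equiv.Perm (Fin n)) (t : Fin n → Circle) :
    MeasurableEmbedding (permTorusAct σ t) := by
  refine Continuous.measurableEmbedding ?_ fun z w h => ?_
  · unfold permTorusAct; fun_prop
  · ext i
    have := congrFun h (σ.symm i)
    simpa [permTorusAct] using this

lemma integral_comp_permTorusAct {n : ℕ} (α : ℝ) (σ : Equiv.Perm (Fin n)) (t : Fin n → Circle)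
    (F : (Fin n → ℂ) → ℂ) :
    ∫ z, F (permTorusAct σ t z) ∂(weightedMeasure n α) = ∫ z, F z ∂(weightedMeasure n α) :=
  (measurePreserving_weightedMeasure α (measurePreserving_permTorusAct σ t)
    (sum_norm_sq_permTorusAct σ t)).integral_comp (measurableEmbedding_permTorusAct σ t) F

/-- If `a` is invariant under the torus, distinct monomials are orthogonal with respect to the
weight `a dv_α`. -/
lemma integral_mul_monomial_eq_zero {n : ℕ} {α : ℝ} {a : (Fin n → ℂ) → ℂ}
    (ha : ∀ t : Fin n → Circle, ∀ᵐ z ∂(weightedMeasure n α), a (permTorusAct 1 t z) = a z)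
    {k m : Fin n → ℕ} (hkm : k ≠ m) :
    ∫ z, a z * ((∏ i, z i ^ k i) * conj (∏ i, z i ^ m i)) ∂(weightedMeasure n α) = 0 := by
  obtain ⟨j, hj⟩ := Function.ne_iff.1 hkm
  have hj' : ((k j : ℝ) - m j) ≠ 0 := sub_ne_zero.2 (by exact_mod_cast hj)
  -- rotating the `j`-th coordinate by this angle multiplies `z^k conj (z^m)` by `-1`
  set u : Circle := Circle.exp (Real.pi / ((k j : ℝ) - m j)) with hu
  have hu1 : (u : ℂ) ^ k j * conj ((u : ℂ) ^ m j) = -1 := by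
    rw [map_pow, ← Circle.coe_inv_eq_conj, hu, ← Circle.exp_neg, Circle.coe_exp, Circle.coe_exp,
      ← Complex.exp_nat_mul, ← Complex.exp_nat_mul, ← Complex.exp_add, ← Complex.exp_pi_mul_I]
    congr 1
    have : ((k j : ℂ) - m j) ≠ 0 := by exact_mod_cast hj'
    push_cast
    field_simp
    ring
  set t : Fin n → Circle := Pi.mulSingle j u with ht
  set I := ∫ z, a z * ((∏ i, z i ^ k i) * conj (∏ i, z i ^ m i)) ∂(weightedMeasure n α) with hI
  have hprod : ∀ l : Fin n → ℕ, ∏ i, (t i : ℂ) ^ l i = (u : ℂ) ^ l j := by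
    intro l
    rw [Finset.prod_eq_single j]
    · simp [ht]
    · intro b _ hb
      simp [ht, Pi.mulSingle_eq_of_ne hb]
    · simp
  have h : I = -I := by
    conv_lhs => rw [hI, ← integral_comp_permTorusAct α 1 t]
    rw [hI, ← integral_neg]
    refine integral_congr_ae ?_
    filter_upwards [ha t] with z hz
    rw [hz]
    simp only [permTorusAct, Equiv.Perm.coe_one, id_eq, mul_pow, Finset.prod_mul_distrib, hprod,
      map_mul]
    calc _ = a z * ((∏ i, z i ^ k i) * conj (∏ i, z i ^ m i)) *
        ((u : ℂ) ^ k j * conj ((u : ℂ) ^ m j)) := by ring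
      _ = _ := by rw [hu1]; ring
  exact self_eq_neg.1 h

/-- The normalizing factor of the monomial `e_m`. -/
noncomputable def basisCoeff {n : ℕ} (α : ℝ) (m : Fin n → ℕ) : ℝ :=
  √(Real.Gamma (n + (∑ i, m i : ℕ) + α + 1) / (multiFactorial m * Real.Gamma (n + α + 1)))

lemma basisMonomial_eq {n : ℕ} (α : ℝ) (m : Fin n → ℕ) (z : Fin n → ℂ) :
    basisMonomial α m z = (basisCoeff α m : ℂ) * ∏ i, z i ^ m i := rfl

lemma continuous_basisMonomial {n : ℕ} (α : ℝ) (m : Fin n → ℕ) :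
    Continuous (basisMonomial α m) := by
  unfold basisMonomial; fun_prop

lemma differentiable_basisMonomial {n : ℕ} (α : ℝ) (m : Fin n → ℕ) :
    Differentiable ℂ (basisMonomial α m) := by
  simp_rw [funext (basisMonomial_eq α m)]
  generalize (basisCoeff α m : ℂ) = c
  fun_prop

/-- The class of `e_m` in the weighted Bergman space. -/
noncomputable def bergmanMonomial {n : ℕ} {α : ℝ} (hα : -1 < α) (m : Fin n → ℕ) :
    bergmanSpace n α :=
  ⟨(memLp_of_continuous hα (continuous_basisMonomial α m) 2).toLp _,
    basisMonomial α m, (differentiable_basisMonomial α m).differentiableOn, MemLp.coeFn_toLp _⟩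

lemma coeFn_bergmanMonomial {n : ℕ} {α : ℝ} (hα : -1 < α) (m : Fin n → ℕ) :
    ((bergmanMonomial hα m : Lp ℂ 2 (weightedMeasure n α)) : (Fin n → ℂ) → ℂ)
      =ᵐ[weightedMeasure n α] basisMonomial α m :=
  (memLp_of_continuous hα (continuous_basisMonomial α m) 2).coeFn_toLp

lemma inner_bergmanMonomial_Lp {n : ℕ} {α : ℝ} (hα : -1 < α) (m : Fin n → ℕ)
    (f : Lp ℂ 2 (weightedMeasure n α)) :
    inner ℂ (bergmanMonomial hα m : Lp ℂ 2 (weightedMeasure n α)) f =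
      ∫ z, f z * conj (basisMonomial α m z) ∂(weightedMeasure n α) := by
  rw [L2.inner_def]
  refine integral_congr_ae ?_
  filter_upwards [coeFn_bergmanMonomial hα m] with z hz
  rw [hz, RCLike.inner_apply]

lemma basisMonomial_mul_conj {n : ℕ} (α : ℝ) (k m : Fin n → ℕ) : ∃ c : ℂ, ∀ z,
    basisMonomial α k z * conj (basisMonomial α m z) =
      c * ((∏ i, z i ^ k i) * conj (∏ i, z i ^ m i)) := by
  refine ⟨basisCoeff α k * conj (basisCoeff α m : ℂ), fun z => ?_⟩
  rw [basisMonomial_eq, basisMonomial_eq, map_mul, mul_mul_mul_comm]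

lemma gamma_pos_of_neg_one_lt (n k : ℕ) {α : ℝ} (hα : -1 < α) :
    0 < Real.Gamma (n + (k : ℕ) + α + 1) := by
  refine Real.Gamma_pos_of_pos ?_
  have h1 : (0 : ℝ) ≤ n := n.cast_nonneg
  have h2 : (0 : ℝ) ≤ k := k.cast_nonneg
  linarith

lemma multiFactorial_pos {n : ℕ} (m : Fin n → ℕ) : 0 < multiFactorial m :=
  Finset.prod_pos fun i _ => (m i).factorial_pos

lemma basisMonomial_mul_conj_self {n : ℕ} {α : ℝ} (hα : -1 < α) (m : Fin n → ℕ) (z : Fin n → ℂ) :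
    basisMonomial α m z * conj (basisMonomial α m z) =
      ((Real.Gamma (n + (∑ i, m i : ℕ) + α + 1) / (multiFactorial m * Real.Gamma (n + α + 1)) *
        ∏ i, ‖z i‖ ^ (2 * m i) : ℝ) : ℂ) := by
  have h1 := gamma_pos_of_neg_one_lt n (∑ i, m i) hα
  have h2 := gamma_add_one_pos n hα
  have h3 : (0 : ℝ) < multiFactorial m := by exact_mod_cast multiFactorial_pos m
  rw [Complex.mul_conj, Complex.normSq_eq_norm_sq]
  congr 1
  rw [basisMonomial, norm_mul, mul_pow, Complex.norm_real, Real.norm_eq_abs, sq_abs,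
    Real.sq_sqrt (by positivity), norm_prod, ← Finset.prod_pow]
  congr 1
  refine Finset.prod_congr rfl fun i _ => ?_
  rw [norm_pow, ← pow_mul, mul_comm]

lemma orthonormal_bergmanMonomial {n : ℕ} {α : ℝ} (hα : -1 < α) :
    Orthonormal ℂ (bergmanMonomial (n := n) hα) := by
  classical
  rw [orthonormal_iff_ite]
  intro m k
  rw [Submodule.coe_inner, inner_bergmanMonomial_Lp]
  have h0 : ∫ z, (bergmanMonomial hα k : Lp ℂ 2 (weightedMeasure n α)) z *
      conj (basisMonomial α m z) ∂(weightedMeasure n α) =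
      ∫ z, basisMonomial α k z * conj (basisMonomial α m z) ∂(weightedMeasure n α) := by
    refine integral_congr_ae ?_
    filter_upwards [coeFn_bergmanMonomial hα k] with z hz
    rw [hz]
  rw [h0]
  split_ifs with h
  · subst h
    simp_rw [basisMonomial_mul_conj_self hα]
    have h1 := gamma_pos_of_neg_one_lt n (∑ i, m i) hα
    have h2 := gamma_add_one_pos n hα
    have h3 : (0 : ℝ) < multiFactorial m := by exact_mod_cast multiFactorial_pos m
    rw [integral_complex_ofReal, integral_const_mul, integral_eq_lintegral_of_nonneg_ae
      (ae_of_all _ fun z => by positivity) (Continuous.aestronglyMeasurable (by fun_prop)),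
      lintegral_prod_norm_pow_weightedMeasure hα, ENNReal.toReal_ofReal (by positivity)]
    norm_cast
    push_cast at h1 ⊢
    field_simp
  · obtain ⟨c, hc⟩ := basisMonomial_mul_conj (n := n) α k m
    simp_rw [hc]
    rw [integral_const_mul]
    have := integral_mul_monomial_eq_zero (α := α) (a := fun _ => (1 : ℂ))
      (fun t => ae_of_all _ fun z => rfl) (Ne.symm h)
    simp only [one_mul] at this
    rw [this, mul_zero]

/-! ### Completeness of the monomials -/

lemma smul_circle_eq_permTorusAct {n : ℕ} (θ : ℝ) (w : Fin n → ℂ) :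
    circleMap 0 1 θ • w = permTorusAct 1 (fun _ => Circle.exp θ) w := by
  ext i
  simp [permTorusAct, circleMap]

lemma MvPolynomial.IsHomogeneous.eval_smul_eq {n k : ℕ} {p : MvPolynomial (Fin n) ℂ}
    (hp : p.IsHomogeneous k) (c : ℂ) (w : Fin n → ℂ) :
    MvPolynomial.eval (c • w) p = c ^ k * MvPolynomial.eval w p := by
  rw [MvPolynomial.eval_eq, MvPolynomial.eval_eq, Finset.mul_sum]
  refine Finset.sum_congr rfl fun d hd => ?_
  have hdeg : d.sum (fun _ e => e) = k := by
    have := hp (MvPolynomial.mem_support_iff.1 hd)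
    rw [Finsupp.weight_apply] at this
    simpa using this
  simp only [Pi.smul_apply, smul_eq_mul, mul_pow, Finset.prod_mul_distrib,
    Finset.prod_pow_eq_pow_sum]
  rw [← hdeg, Finsupp.sum]
  ring

lemma integral_mul_conj_eval_eq_zero {n : ℕ} {α : ℝ} {g : (Fin n → ℂ) → ℂ}
    (hg : Integrable g (weightedMeasure n α))
    (h0 : ∀ m : Fin n → ℕ, ∫ z, g z * conj (∏ i, z i ^ m i) ∂(weightedMeasure n α) = 0)
    (p : MvPolynomial (Fin n) ℂ) :
    ∫ z, g z * conj (MvPolynomial.eval z p) ∂(weightedMeasure n α) = 0 := by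
  simp_rw [MvPolynomial.eval_eq', map_sum, map_mul (starRingEnd ℂ) (MvPolynomial.coeff _ _),
    Finset.mul_sum, mul_left_comm (g _)]
  rw [integral_finsetSum]
  · refine Finset.sum_eq_zero fun d _ => ?_
    rw [integral_const_mul, h0 d, mul_zero]
  · intro d _
    refine Integrable.const_mul ?_ _
    obtain ⟨C, hC⟩ := exists_bound_on_unitBall (n := n)
      (h := fun z => conj (∏ i, z i ^ d i)) (by fun_prop)
    exact hg.mul_bdd (c := C) (Continuous.aestronglyMeasurable (by fun_prop))
      ((ae_weightedMeasure_mem_unitBall n α).mono hC)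

/-- A holomorphic function orthogonal to all monomials vanishes. By rotation invariance, each of its
homogeneous components is orthogonal to itself. -/
lemma ae_eq_zero_of_integral_mul_conj_monomial_eq_zero {n : ℕ} {α : ℝ} (hα : -1 < α)
    {g : (Fin n → ℂ) → ℂ} (hd : DifferentiableOn ℂ g (unitBall n))
    (hg : Integrable g (weightedMeasure n α))
    (h0 : ∀ m : Fin n → ℕ, ∫ z, g z * conj (∏ i, z i ^ m i) ∂(weightedMeasure n α) = 0) :
    g =ᵐ[weightedMeasure n α] 0 := by
  have := isProbabilityMeasure_weightedMeasure n hα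
  obtain ⟨p, hp, hexp⟩ := exists_homogeneous_expansion hd
  set μ := weightedMeasure n α with hμ
  set ν : Measure ℝ := volume.restrict (Set.Ioc 0 (2 * Real.pi)) with hν
  have hball := ae_weightedMeasure_mem_unitBall n α
  have hcirc := continuous_circleMap 0 1
  have hcn : ∀ θ, circleMap 0 1 θ ≠ 0 := fun θ => circleMap_ne_center one_ne_zero
  have hpc : ∀ k, Continuous fun w => MvPolynomial.eval w (p k) := fun k =>
    MvPolynomial.continuous_eval (p k)
  have hΨ : MeasurePreserving (fun q : ℝ × (Fin n → ℂ) => (q.1, circleMap 0 1 q.1 • q.2))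
      (ν.prod μ) (ν.prod μ) := by
    refine (MeasurePreserving.id ν).skew_product (g := fun θ w => circleMap 0 1 θ • w) ?_ ?_
    · exact Continuous.measurable (by fun_prop)
    · refine ae_of_all _ fun θ => ?_
      simp_rw [smul_circle_eq_permTorusAct]
      exact (measurePreserving_weightedMeasure α (measurePreserving_permTorusAct _ _)
        (sum_norm_sq_permTorusAct _ _)).map_eq
  -- the homogeneous component of degree `k` is orthogonal to itself
  have hzero : ∀ k, (fun w => MvPolynomial.eval w (p k)) =ᵐ[μ] 0 := by
    intro k
    obtain ⟨C, hC⟩ := exists_bound_on_unitBall (hpc k)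
    have hint : Integrable (Function.uncurry fun (θ : ℝ) (w : Fin n → ℂ) =>
        g (circleMap 0 1 θ • w) * ((circleMap 0 1 θ ^ k)⁻¹ * conj (MvPolynomial.eval w (p k))))
        (ν.prod μ) := by
      have h1 : Integrable (fun q : ℝ × (Fin n → ℂ) => g q.2) (ν.prod μ) := hg.comp_snd ν
      have h2 : Integrable (fun q : ℝ × (Fin n → ℂ) => g (circleMap 0 1 q.1 • q.2)) (ν.prod μ) :=
        (hΨ.integrable_comp h1.aestronglyMeasurable).2 h1
      refine h2.mul_bdd (c := C) (Continuous.aestronglyMeasurable ?_) ?_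
      · refine Continuous.mul (Continuous.inv₀ (by fun_prop) fun q => pow_ne_zero _ (hcn _)) ?_
        exact Complex.continuous_conj.comp ((hpc k).comp continuous_snd)
      · filter_upwards [Measure.quasiMeasurePreserving_snd.ae hball] with q hq
        simpa using hC q.2 hq
    have hin : ∀ θ : ℝ, ∫ w, g (circleMap 0 1 θ • w) *
        ((circleMap 0 1 θ ^ k)⁻¹ * conj (MvPolynomial.eval w (p k))) ∂μ = 0 := by
      intro θ
      have h1 := integral_comp_permTorusAct α 1 (fun _ : Fin n => Circle.exp θ)
        (fun u => g u * ((circleMap 0 1 θ ^ k)⁻¹ *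
          conj (MvPolynomial.eval ((circleMap 0 1 θ)⁻¹ • u) (p k))))
      simp_rw [← smul_circle_eq_permTorusAct, inv_smul_smul₀ (hcn θ), (hp k).eval_smul_eq, map_mul]
        at h1
      rw [hμ, h1]
      simp_rw [mul_left_comm (g _)]
      rw [integral_const_mul, integral_const_mul, integral_mul_conj_eval_eq_zero hg h0, mul_zero,
        mul_zero]
    have hswap := integral_integral_swap hint
    simp_rw [hin, integral_zero] at hswap
    have hnorm : ∫ w, ‖MvPolynomial.eval w (p k)‖ ^ 2 ∂μ = 0 := by
      have h1 : ∫ w, ((2 * Real.pi * ‖MvPolynomial.eval w (p k)‖ ^ 2 : ℝ) : ℂ) ∂μ = 0 := by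
        rw [hswap]
        refine integral_congr_ae ?_
        filter_upwards [hball] with w hw
        have h2 := (hexp w hw).2 k
        have h3 : ∀ θ, g (circleMap 0 1 θ • w) *
            ((circleMap 0 1 θ ^ k)⁻¹ * conj (MvPolynomial.eval w (p k))) =
            ((circleMap 0 1 θ ^ k)⁻¹ * g (circleMap 0 1 θ • w)) *
              conj (MvPolynomial.eval w (p k)) := fun θ => by ring
        simp_rw [h3]
        rw [integral_mul_const, ← h2, mul_assoc (2 * Real.pi : ℂ), Complex.mul_conj,
          Complex.normSq_eq_norm_sq]
        push_cast
        ring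
      rw [integral_complex_ofReal, integral_const_mul] at h1
      have h2 := Complex.ofReal_eq_zero.1 h1
      exact (mul_eq_zero.1 h2).resolve_left Real.two_pi_pos.ne'
    have hi : Integrable (fun w => ‖MvPolynomial.eval w (p k)‖ ^ 2) μ := by
      refine Integrable.of_bound (Continuous.aestronglyMeasurable (by fun_prop)) (C ^ 2) ?_
      filter_upwards [hball] with w hw
      rw [norm_pow, norm_norm]
      exact pow_le_pow_left₀ (norm_nonneg _) (hC w hw) 2
    rw [integral_eq_zero_iff_of_nonneg (fun w => by positivity) hi] at hnorm
    filter_upwards [hnorm] with w hw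
    simpa using hw
  filter_upwards [hball, ae_all_iff.2 hzero] with w hw hk
  have h1 := (hexp w hw).1
  have h2 : (fun k => MvPolynomial.eval w (p k)) = fun _ => 0 := funext hk
  rw [h2] at h1
  exact h1.unique hasSum_zero

lemma span_bergmanMonomial_orthogonal {n : ℕ} {α : ℝ} (hα : -1 < α) :
    (Submodule.span ℂ (Set.range (bergmanMonomial (n := n) hα)))ᗮ = ⊥ := by
  have := isProbabilityMeasure_weightedMeasure n hα
  rw [Submodule.eq_bot_iff]
  intro f hf
  rw [Submodule.mem_orthogonal] at hf
  have hL := (Lp.memLp (f : Lp ℂ 2 (weightedMeasure n α)))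
  have hfi := hL.integrable one_le_two
  obtain ⟨g, hd, hfg⟩ := f.2
  have h0 : ∀ m : Fin n → ℕ, ∫ z, g z * conj (∏ i, z i ^ m i) ∂(weightedMeasure n α) = 0 := by
    intro m
    have h1 := hf _ (Submodule.subset_span (Set.mem_range_self m))
    rw [Submodule.coe_inner, inner_bergmanMonomial_Lp] at h1
    have h2 : ∫ z, (f : Lp ℂ 2 (weightedMeasure n α)) z * conj (basisMonomial α m z)
        ∂(weightedMeasure n α) =
        conj (basisCoeff α m : ℂ) * ∫ z, g z * conj (∏ i, z i ^ m i) ∂(weightedMeasure n α) := by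
      rw [← integral_const_mul]
      refine integral_congr_ae ?_
      filter_upwards [hfg] with z hz
      rw [hz, basisMonomial_eq, map_mul]
      ring
    rw [h2] at h1
    refine (mul_eq_zero.1 h1).resolve_left ?_
    have e1 := gamma_pos_of_neg_one_lt n (∑ i, m i) hα
    have e2 := gamma_add_one_pos n hα
    have e3 : (0 : ℝ) < multiFactorial m := by exact_mod_cast multiFactorial_pos m
    have : 0 < basisCoeff α m := Real.sqrt_pos.2 (by positivity)
    simp [this.ne']
  have hg0 := ae_eq_zero_of_integral_mul_conj_monomial_eq_zero hα hd (hfi.congr hfg) h0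
  refine Subtype.ext ((Lp.eq_zero_iff_ae_eq_zero).2 (hfg.trans hg0))

/-- The Hilbert basis `(e_m)` of the weighted Bergman space. -/
noncomputable def bergmanBasis {n : ℕ} {α : ℝ} (hα : -1 < α) :
    HilbertBasis (Fin n → ℕ) ℂ (bergmanSpace n α) :=
  HilbertBasis.mkOfOrthogonalEqBot (orthonormal_bergmanMonomial hα)
    (span_bergmanMonomial_orthogonal hα)

lemma bergmanBasis_apply {n : ℕ} {α : ℝ} (hα : -1 < α) (m : Fin n → ℕ) :
    bergmanBasis hα m = bergmanMonomial hα m := by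
  rw [bergmanBasis, HilbertBasis.coe_mkOfOrthogonalEqBot]

/-! ### The Bergman kernel -/

/-- The Taylor coefficient `Γ(s + k) / (k! Γ(s))` of `(1 - x)^{-s}`. -/
noncomputable def kernelCoeff (s : ℝ) (k : ℕ) : ℝ :=
  Real.Gamma (s + k) / (k.factorial * Real.Gamma s)

lemma kernelCoeff_nonneg {s : ℝ} (hs : 0 < s) (k : ℕ) : 0 ≤ kernelCoeff s k := by
  have h1 := Real.Gamma_pos_of_pos hs
  have h2 := Real.Gamma_pos_of_pos (show 0 < s + k by positivity)
  unfold kernelCoeff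
  positivity

lemma hasSum_kernelCoeff_mul_pow {s : ℝ} (hs : 0 < s) {x : ℂ} (hx : ‖x‖ < 1) :
    HasSum (fun k => (kernelCoeff s k : ℂ) * x ^ k) ((1 - x) ^ (-(s : ℂ))) := by
  have h := (Complex.one_div_one_sub_cpow_hasFPowerSeriesOnBall_zero (s : ℂ)).hasSum (y := x)
    (by rwa [Metric.mem_eball, edist_zero_right, ← ofReal_norm, ENNReal.ofReal_lt_one])
  simp only [zero_add, one_div, ← Complex.cpow_neg] at h
  refine h.congr_fun fun k => ?_
  rw [FormalMultilinearSeries.ofScalars_apply_eq, smul_eq_mul]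
  congr 1
  have hk : (k.factorial : ℂ) ≠ 0 := by exact_mod_cast k.factorial_ne_zero
  have hG : Complex.Gamma s ≠ 0 := by
    rw [Complex.Gamma_ofReal]
    exact_mod_cast (Real.Gamma_pos_of_pos hs).ne'
  have h1 := Ring.factorial_nsmul_multichoose_eq_ascPochhammer (s : ℂ) k
  rw [Polynomial.ascPochhammer_smeval_eq_eval, ← Complex.Gamma_add_nat_div_Gamma_eq _ (fun j h => by
    have h2 : s = -(j : ℝ) := by exact_mod_cast h
    have h3 : (0 : ℝ) ≤ j := j.cast_nonneg
    linarith), Ring.multichoose_eq, nsmul_eq_mul] at h1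
  rw [kernelCoeff]
  push_cast
  rw [← Complex.Gamma_ofReal, ← Complex.Gamma_ofReal]
  push_cast
  rw [div_mul_eq_div_div_swap, ← h1]
  field_simp

lemma basisCoeff_sq {n : ℕ} {α : ℝ} (hα : -1 < α) (m : Fin n → ℕ) :
    basisCoeff α m ^ 2 = Real.Gamma (n + (∑ i, m i : ℕ) + α + 1) /
      (multiFactorial m * Real.Gamma (n + α + 1)) := by
  have e1 := gamma_pos_of_neg_one_lt n (∑ i, m i) hα
  have e2 := gamma_add_one_pos n hα
  exact Real.sq_sqrt (by positivity)

/-- The component of degree `k` of the Bergman kernel `(1 - z · w̄)^{-(n + α + 1)}` is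
`∑_{|m| = k} e_m(z) conj (e_m(w))`, by the multinomial theorem. -/
lemma kernelCoeff_mul_pow_eq_sum {n : ℕ} {α : ℝ} (hα : -1 < α) (z w : Fin n → ℂ) (k : ℕ) :
    (kernelCoeff (n + α + 1) k : ℂ) * (∑ i, z i * conj (w i)) ^ k =
      ∑ m ∈ Finset.univ.piAntidiag k, basisMonomial α m z * conj (basisMonomial α m w) := by
  rw [Finset.sum_pow_eq_sum_piAntidiag, Finset.mul_sum]
  refine Finset.sum_congr rfl fun m hm => ?_
  have hmk : ∑ i, m i = k := (Finset.mem_piAntidiag.1 hm).1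
  have hspec := Nat.multinomial_spec Finset.univ m
  rw [hmk] at hspec
  have hc : kernelCoeff (n + α + 1) k * (Nat.multinomial Finset.univ m : ℝ) =
      basisCoeff α m ^ 2 := by
    rw [basisCoeff_sq hα, kernelCoeff, hmk, multiFactorial, ← hspec]
    have e2 := gamma_add_one_pos n hα
    have e3 : (0 : ℝ) < ∏ i, ((m i).factorial : ℝ) :=
      Finset.prod_pos fun i _ => by exact_mod_cast (m i).factorial_pos
    have e4 : (0 : ℝ) < Nat.multinomial Finset.univ m := by
      exact_mod_cast Nat.multinomial_pos Finset.univ m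
    push_cast
    rw [show (n : ℝ) + α + 1 + k = n + k + α + 1 by ring]
    field_simp
  have hc' : (kernelCoeff (n + α + 1) k : ℂ) * (Nat.multinomial Finset.univ m : ℂ) =
      (basisCoeff α m : ℂ) ^ 2 := by exact_mod_cast hc
  rw [basisMonomial_eq, basisMonomial_eq, map_mul, Complex.conj_ofReal, ← mul_assoc, hc']
  simp only [mul_pow, Finset.prod_mul_distrib, map_prod, map_pow]
  ring

lemma norm_sum_mul_conj_le {n : ℕ} (z : Fin n → ℂ) {w : Fin n → ℂ} (hw : w ∈ unitBall n) :
    ‖∑ i, z i * conj (w i)‖ ≤ √(∑ i, ‖z i‖ ^ 2) := by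
  refine (norm_sum_le _ _).trans (Real.le_sqrt_of_sq_le ?_)
  simp only [norm_mul, RCLike.norm_conj]
  refine (Finset.sum_mul_sq_le_sq_mul_sq _ _ _).trans ?_
  have h1 : ∑ i, ‖w i‖ ^ 2 < 1 := hw
  have h2 : 0 ≤ ∑ i, ‖z i‖ ^ 2 := by positivity
  nlinarith

/-- For fixed `z` in the ball the kernel series converges uniformly in `w`, hence may be integrated
term by term. -/
lemma hasSum_integral_kernel {n : ℕ} {α : ℝ} (hα : -1 < α) {g : (Fin n → ℂ) → ℂ}
    (hg : Integrable g (weightedMeasure n α)) {z : Fin n → ℂ} (hz : z ∈ unitBall n) :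
    HasSum (fun k => ∑ m ∈ Finset.univ.piAntidiag k, basisMonomial α m z *
        ∫ w, g w * conj (basisMonomial α m w) ∂(weightedMeasure n α))
      (∫ w, g w * (1 - ∑ i, z i * conj (w i)) ^ (-((n : ℂ) + (α : ℂ) + 1))
        ∂(weightedMeasure n α)) := by
  have hs : (0 : ℝ) < n + α + 1 := by
    have : (0 : ℝ) ≤ n := n.cast_nonneg
    linarith
  have hball := ae_weightedMeasure_mem_unitBall n α
  set ρ := √(∑ i, ‖z i‖ ^ 2) with hρ
  have hρ1 : ρ < 1 := by
    rw [hρ, Real.sqrt_lt' one_pos, one_pow]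
    exact hz
  have hρ0 : 0 ≤ ρ := Real.sqrt_nonneg _
  have hsum : Summable fun k => kernelCoeff (n + α + 1) k * ρ ^ k := by
    have h := (hasSum_kernelCoeff_mul_pow hs (x := (ρ : ℂ)) (by
      simpa [abs_of_nonneg hρ0] using hρ1)).summable
    exact_mod_cast h
  have hdom := hasSum_integral_of_dominated_convergence (μ := weightedMeasure n α)
    (F := fun k w => g w * ((kernelCoeff (n + α + 1) k : ℂ) * (∑ i, z i * conj (w i)) ^ k))
    (f := fun w => g w * (1 - ∑ i, z i * conj (w i)) ^ (-((n : ℂ) + (α : ℂ) + 1)))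
    (fun k w => ‖g w‖ * (kernelCoeff (n + α + 1) k * ρ ^ k))
    (fun k => hg.aestronglyMeasurable.mul (Continuous.aestronglyMeasurable (by fun_prop)))
    (fun k => ?_) (ae_of_all _ fun w => hsum.mul_left _) ?_ ?_
  · refine hdom.congr_fun fun k => ?_
    simp_rw [kernelCoeff_mul_pow_eq_sum hα, Finset.mul_sum, mul_left_comm (g _)]
    rw [integral_finsetSum]
    · exact Finset.sum_congr rfl fun m _ => (integral_const_mul _ _).symm
    · intro m _
      refine Integrable.const_mul ?_ _
      obtain ⟨C, hC⟩ := exists_bound_on_unitBall (continuous_basisMonomial α m)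
      refine hg.mul_bdd (c := C) (Continuous.aestronglyMeasurable
        (Complex.continuous_conj.comp (continuous_basisMonomial α m))) ?_
      filter_upwards [hball] with w hw
      simpa using hC w hw
  · filter_upwards [hball] with w hw
    rw [norm_mul, norm_mul, norm_pow, Complex.norm_real, Real.norm_eq_abs,
      abs_of_nonneg (kernelCoeff_nonneg hs k)]
    have := norm_sum_mul_conj_le z hw
    have h0 := kernelCoeff_nonneg hs k
    gcongr
  · simp_rw [tsum_mul_left]
    exact hg.norm.mul_const _
  · filter_upwards [hball] with w hw
    have h := hasSum_kernelCoeff_mul_pow hs (x := ∑ i, z i * conj (w i))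
      ((norm_sum_mul_conj_le z hw).trans_lt hρ1)
    push_cast at h
    exact h.mul_left _

/-- The orthogonal projection onto the Bergman space is the integral operator with the Bergman
kernel: the expansion of the projection converges in `L²`, hence almost everywhere along a subsequence,
and the pointwise limit is the kernel integral. -/
lemma coeFn_orthogonalProjectionOnto_bergmanSpace {n : ℕ} {α : ℝ} (hα : -1 < α)
    (g : Lp ℂ 2 (weightedMeasure n α)) :
    (((bergmanSpace n α).orthogonalProjectionOnto g : Lp ℂ 2 (weightedMeasure n α)) :
      (Fin n → ℂ) → ℂ) =ᵐ[weightedMeasure n α]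
      fun z => ∫ w, g w * (1 - ∑ i, z i * conj (w i)) ^ (-((n : ℂ) + (α : ℂ) + 1))
        ∂(weightedMeasure n α) := by
  have := isProbabilityMeasure_weightedMeasure n hα
  set u := (bergmanSpace n α).orthogonalProjectionOnto g with hu
  set c : (Fin n → ℕ) → ℂ := fun m =>
    ∫ w, g w * conj (basisMonomial α m w) ∂(weightedMeasure n α) with hc
  have hcoef : ∀ m, (bergmanBasis hα).repr u m = c m := by
    intro m
    rw [HilbertBasis.repr_apply_apply, bergmanBasis_apply, hc]
    simp only
    rw [← inner_bergmanMonomial_Lp hα, hu]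
    exact Submodule.inner_orthogonalProjectionOnto_eq_of_mem_left (K := bergmanSpace n α) _ _
  have h1 := (bergmanBasis hα).hasSum_repr u
  simp_rw [hcoef, bergmanBasis_apply] at h1
  have h2 := h1.mapL (bergmanSpace n α).subtypeL
  -- the partial sums over the monomials of degree less than `N`
  set A : ℕ → Finset (Fin n → ℕ) := fun N =>
    (Finset.range N).biUnion fun k => Finset.univ.piAntidiag k with hA
  have hAmono : Monotone A := fun N M h =>
    Finset.biUnion_subset_biUnion_of_subset_left _ (Finset.range_mono h)
  have hAt : Tendsto A atTop atTop := by
    refine tendsto_atTop_finset_of_monotone hAmono fun m => ⟨(∑ i, m i) + 1, ?_⟩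
    rw [hA, Finset.mem_biUnion]
    exact ⟨∑ i, m i, by simp, by simp [Finset.mem_piAntidiag]⟩
  have h3 := Tendsto.comp h2 hAt
  have hS : ∀ B : Finset (Fin n → ℕ), ((∑ m ∈ B, (bergmanSpace n α).subtypeL
      (c m • bergmanMonomial hα m) : Lp ℂ 2 (weightedMeasure n α)) : (Fin n → ℂ) → ℂ)
      =ᵐ[weightedMeasure n α] fun z => ∑ m ∈ B, basisMonomial α m z * c m := by
    intro B
    refine (Lp.coeFn_fun_finsetSum _ _).trans ?_
    have h4 : ∀ m, (((bergmanSpace n α).subtypeL (c m • bergmanMonomial hα m) :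
        Lp ℂ 2 (weightedMeasure n α)) : (Fin n → ℂ) → ℂ) =ᵐ[weightedMeasure n α]
        fun z => basisMonomial α m z * c m := by
      intro m
      rw [map_smul]
      filter_upwards [Lp.coeFn_smul (c m) ((bergmanSpace n α).subtypeL (bergmanMonomial hα m)),
        coeFn_bergmanMonomial hα m] with z hz1 hz2
      rw [hz1, Pi.smul_apply, Submodule.subtypeL_apply, hz2, smul_eq_mul, mul_comm]
    filter_upwards [ae_all_iff.2 h4] with z hz
    exact Finset.sum_congr rfl fun m _ => hz m
  obtain ⟨ns, hns, hae⟩ := (tendstoInMeasure_of_tendsto_Lp h3).exists_seq_tendsto_ae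
  have hg := (Lp.memLp g).integrable one_le_two
  filter_upwards [hae, ae_weightedMeasure_mem_unitBall n α, ae_all_iff.2 fun N => hS (A N)]
    with z hz1 hz hz3
  have h5 := (hasSum_integral_kernel hα hg hz).tendsto_sum_nat.comp hns.tendsto_atTop
  refine tendsto_nhds_unique hz1 (h5.congr fun j => ?_)
  simp only [Function.comp_apply, hz3]
  rw [hA]
  simp only
  rw [Finset.sum_biUnion]
  intro k _ l _ hkl
  refine Finset.disjoint_left.2 fun m hm hm' => hkl ?_
  rw [← (Finset.mem_piAntidiag.1 hm).1, (Finset.mem_piAntidiag.1 hm').1]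

/-! ### Toeplitz operators -/

/-- The compression to the Bergman space of the multiplication by a bounded symbol `a`. -/
noncomputable def toeplitzOperator {n : ℕ} {α : ℝ} {a : (Fin n → ℂ) → ℂ}
    (ha : MemLp a ∞ (weightedMeasure n α)) : bergmanSpace n α →L[ℂ] bergmanSpace n α :=
  (bergmanSpace n α).orthogonalProjectionOnto ∘L
    ((ContinuousLinearMap.mul ℂ ℂ).holderL (weightedMeasure n α) ∞ 2 2 (ha.toLp a)) ∘L
    (bergmanSpace n α).subtypeL

lemma coeFn_holder_mul {n : ℕ} {α : ℝ} {a : (Fin n → ℂ) → ℂ}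
    (ha : MemLp a ∞ (weightedMeasure n α)) (f : Lp ℂ 2 (weightedMeasure n α)) :
    ((ContinuousLinearMap.mul ℂ ℂ).holder 2 (ha.toLp a) f : (Fin n → ℂ) → ℂ)
      =ᵐ[weightedMeasure n α] fun z => a z * f z := by
  filter_upwards [(ContinuousLinearMap.mul ℂ ℂ).coeFn_holder (r := 2) (ha.toLp a) f,
    ha.coeFn_toLp] with z h1 h2
  rw [h1, h2, ContinuousLinearMap.mul_apply']

lemma isToeplitzOperator_toeplitzOperator {n : ℕ} {α : ℝ} (hα : -1 < α) {a : (Fin n → ℂ) → ℂ}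
    (ha : MemLp a ∞ (weightedMeasure n α)) : IsToeplitzOperator a (toeplitzOperator ha) := by
  intro f
  refine (coeFn_orthogonalProjectionOnto_bergmanSpace hα _).trans (ae_of_all _ fun z => ?_)
  refine integral_congr_ae ?_
  filter_upwards [coeFn_holder_mul ha (f : Lp ℂ 2 (weightedMeasure n α))] with w hw
  exact congrArg (· * _) hw

lemma IsToeplitzOperator.unique {n : ℕ} {α : ℝ} {a : (Fin n → ℂ) → ℂ}
    {S T : bergmanSpace n α →L[ℂ] bergmanSpace n α} (hS : IsToeplitzOperator a S)
    (hT : IsToeplitzOperator a T) : S = T :=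
  ContinuousLinearMap.ext fun f => Subtype.ext (Lp.ext ((hS f).trans (hT f).symm))

lemma inner_bergmanMonomial_toeplitzOperator {n : ℕ} {α : ℝ} (hα : -1 < α)
    {a : (Fin n → ℂ) → ℂ} (ha : MemLp a ∞ (weightedMeasure n α)) (m k : Fin n → ℕ) :
    inner ℂ (bergmanMonomial hα m) (toeplitzOperator ha (bergmanMonomial hα k)) =
      ∫ z, a z * (basisMonomial α k z * conj (basisMonomial α m z)) ∂(weightedMeasure n α) := by
  rw [toeplitzOperator, ContinuousLinearMap.comp_apply,
    Submodule.inner_orthogonalProjectionOnto_eq_of_mem_left (K := bergmanSpace n α),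
    inner_bergmanMonomial_Lp]
  refine integral_congr_ae ?_
  filter_upwards [coeFn_holder_mul ha (bergmanMonomial hα k : Lp ℂ 2 (weightedMeasure n α)),
    coeFn_bergmanMonomial hα k] with z h1 h2
  simp only [ContinuousLinearMap.comp_apply, ContinuousLinearMap.holderL_apply_apply,
    Submodule.subtypeL_apply]
  rw [h1, h2, mul_assoc]

/-! ### Operators diagonal in a Hilbert basis -/

section Diagonal

variable {ι H : Type*} [NormedAddCommGroup H] [InnerProductSpace ℂ H]

/-- `T` is diagonal in the Hilbert basis `b`, with eigenvalues `γ`. -/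
def IsDiagonalWith (b : HilbertBasis ι ℂ H) (γ : ι → ℂ) (T : H →L[ℂ] H) : Prop :=
  ∀ f i, b.repr (T f) i = γ i * b.repr f i

lemma IsDiagonalWith.mul_comm {b : HilbertBasis ι ℂ H} {γ δ : ι → ℂ} {S T : H →L[ℂ] H}
    (hS : IsDiagonalWith b γ S) (hT : IsDiagonalWith b δ T) : S * T = T * S := by
  ext f
  refine b.repr.injective (lp.ext (funext fun i => ?_))
  rw [mul_apply_eq_comp, mul_apply_eq_comp, hS, hT, hT, hS]
  ring

variable [CompleteSpace H]

lemma IsDiagonalWith.star {b : HilbertBasis ι ℂ H} {γ : ι → ℂ} {T : H →L[ℂ] H}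
    (hT : IsDiagonalWith b γ T) : IsDiagonalWith b (fun i => conj (γ i)) (star T) := by
  classical
  intro f i
  have h1 : T (b i) = γ i • b i := by
    refine b.repr.injective (lp.ext (funext fun j => ?_))
    rw [hT, map_smul, lp.coeFn_smul, Pi.smul_apply, b.repr_self, smul_eq_mul]
    by_cases h : j = i
    · rw [h]
    · simp [lp.single_apply, h]
  rw [ContinuousLinearMap.star_eq_adjoint, b.repr_apply_apply, b.repr_apply_apply,
    ContinuousLinearMap.adjoint_inner_right, h1, inner_smul_left]

/-- A bounded operator whose matrix is diagonal is a diagonal operator. The proof computes the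
adjoint on the basis vectors. -/
lemma isDiagonalWith_of_inner_eq_zero {b : HilbertBasis ι ℂ H} {T : H →L[ℂ] H}
    (h : ∀ i j, i ≠ j → inner ℂ (b i) (T (b j)) = 0) :
    IsDiagonalWith b (fun i => inner ℂ (b i) (T (b i))) T := by
  classical
  have hdiag : IsDiagonalWith b (fun i => inner ℂ (b i) (T (b i))) (star (star T)) := by
    have hs : ∀ i, (star T) (b i) = conj (inner ℂ (b i) (T (b i))) • b i := by
      intro i
      refine b.repr.injective (lp.ext (funext fun j => ?_))
      rw [map_smul, lp.coeFn_smul, Pi.smul_apply, b.repr_self, b.repr_apply_apply,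
        ContinuousLinearMap.star_eq_adjoint, ContinuousLinearMap.adjoint_inner_right, smul_eq_mul]
      by_cases hij : j = i
      · subst hij
        simp
      · rw [← inner_conj_symm, h i j (Ne.symm hij)]
        simp [lp.single_apply, hij]
    intro f i
    rw [ContinuousLinearMap.star_eq_adjoint, b.repr_apply_apply, b.repr_apply_apply,
      ContinuousLinearMap.adjoint_inner_right, hs, inner_smul_left, RCLike.conj_conj]
  rwa [star_star] at hdiag

/-- Commutation with generators and their adjoints passes to the closed `*`-algebra they generate. -/
lemma generatedCStarAlgebra_mul_comm {S : Set (H →L[ℂ] H)} (b : HilbertBasis ι ℂ H)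
    (hS : ∀ T ∈ S, ∃ γ, IsDiagonalWith b γ T) :
    ∀ A ∈ generatedCStarAlgebra S, ∀ B ∈ generatedCStarAlgebra S, A * B = B * A := by
  have hcomm : ∀ x ∈ S, ∀ y ∈ S, x * y = y * x := by
    intro x hx y hy
    obtain ⟨γ, hγ⟩ := hS x hx
    obtain ⟨δ, hδ⟩ := hS y hy
    exact hγ.mul_comm hδ
  have hcommstar : ∀ x ∈ S, ∀ y ∈ S, x * star y = star y * x := by
    intro x hx y hy
    obtain ⟨γ, hγ⟩ := hS x hx
    obtain ⟨δ, hδ⟩ := hS y hy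
    exact hγ.mul_comm hδ.star
  have hadj := StarAlgebra.isMulCommutative_adjoin ℂ hcomm hcommstar
  let _ := (StarAlgebra.adjoin ℂ S).commRingTopologicalClosure fun x y => mul_comm' x y
  intro A hA B hB
  have h := mul_comm (⟨A, hA⟩ : (StarAlgebra.adjoin ℂ S).topologicalClosure) ⟨B, hB⟩
  exact congrArg Subtype.val h

end Diagonal

/-! ### Diagonalization of Toeplitz operators -/

/-- The diagonal matrix entry `⟨a e_m, e_m⟩`. -/
noncomputable def toeplitzEigenvalue {n : ℕ} (α : ℝ) (a : (Fin n → ℂ) → ℂ) (m : Fin n → ℕ) : ℂ :=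
  ∫ z, a z * (basisMonomial α m z * conj (basisMonomial α m z)) ∂(weightedMeasure n α)

lemma isDiagonalWith_toeplitzOperator {n : ℕ} {α : ℝ} (hα : -1 < α) {a : (Fin n → ℂ) → ℂ}
    (ha : MemLp a ∞ (weightedMeasure n α))
    (hinv : ∀ t : Fin n → Circle, ∀ᵐ z ∂(weightedMeasure n α), a (permTorusAct 1 t z) = a z) :
    IsDiagonalWith (bergmanBasis hα) (toeplitzEigenvalue α a) (toeplitzOperator ha) := by
  have h := isDiagonalWith_of_inner_eq_zero (b := bergmanBasis hα) (T := toeplitzOperator ha) ?_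
  · simp_rw [bergmanBasis_apply, inner_bergmanMonomial_toeplitzOperator] at h
    exact h
  · intro m k hmk
    rw [bergmanBasis_apply, bergmanBasis_apply, inner_bergmanMonomial_toeplitzOperator]
    obtain ⟨c, hc⟩ := basisMonomial_mul_conj (n := n) α k m
    simp_rw [hc, mul_left_comm _ c]
    rw [integral_const_mul, integral_mul_monomial_eq_zero hinv (Ne.symm hmk), mul_zero]

lemma basisMonomial_comp_perm {n : ℕ} (α : ℝ) (m : Fin n → ℕ) (σ : Equiv.Perm (Fin n))
    (z : Fin n → ℂ) :
    basisMonomial α (fun i => m (σ i)) (fun i => z (σ i)) = basisMonomial α m z := by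
  rw [basisMonomial_eq, basisMonomial_eq, basisCoeff, basisCoeff, multiFactorial, multiFactorial,
    Equiv.sum_comp σ m, Equiv.prod_comp σ fun i => (m i).factorial,
    Equiv.prod_comp σ fun i => z i ^ m i]

lemma toeplitzEigenvalue_comp_perm {n : ℕ} {α : ℝ} {a : (Fin n → ℂ) → ℂ}
    (σ : Equiv.Perm (Fin n))
    (ha : ∀ᵐ z ∂(weightedMeasure n α), a (fun i => z (σ i)) = a z) (m : Fin n → ℕ) :
    toeplitzEigenvalue α a (fun i => m (σ i)) = toeplitzEigenvalue α a m := by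
  have h1 : ∀ z : Fin n → ℂ, permTorusAct σ 1 z = fun i => z (σ i) := by
    intro z; ext i; simp [permTorusAct]
  rw [toeplitzEigenvalue, ← integral_comp_permTorusAct α σ 1]
  refine integral_congr_ae ?_
  filter_upwards [ha] with z hz
  rw [h1, hz, basisMonomial_comp_perm]

lemma measurableSet_radialBall (n : ℕ) : MeasurableSet (radialBall n) := by
  refine MeasurableSet.inter (s₁ := {r : Fin n → ℝ | ∀ i, 0 ≤ r i})
    (s₂ := {r | ∑ i, r i ^ 2 < 1}) ?_ (measurableSet_lt (by fun_prop) measurable_const)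
  have : {r : Fin n → ℝ | ∀ i, 0 ≤ r i} = Set.univ.pi fun _ => Set.Ici 0 := by
    ext; simp [Pi.le_def]
  rw [this]
  exact MeasurableSet.univ_pi fun _ => measurableSet_Ici

/-- The image of `v_α` under `z ↦ (|z₁|, …, |zₙ|)`. -/
lemma map_norm_weightedMeasure {n : ℕ} (α : ℝ) :
    (weightedMeasure n α).map (fun z i => ‖z i‖) =
      ENNReal.ofReal (weightConst n α * (n.factorial / Real.pi ^ n)) •
        (volume.restrict (radialBall n)).withDensity
          (fun r => ENNReal.ofReal ((1 - ∑ i, r i ^ 2) ^ α * ∏ i, (2 * Real.pi * r i))) := by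
  have hm : Measurable fun (z : Fin n → ℂ) i => ‖z i‖ := by fun_prop
  have ht := measurable_truncPow α
  have hpos := measurableSet_forall_pos n
  have hrad := measurableSet_radialBall n
  ext s hs
  have hind : Measurable (s.indicator (1 : (Fin n → ℝ) → ℝ≥0∞)) := measurable_one.indicator hs
  have hg : Measurable fun r : Fin n → ℝ => truncPow (1 - ∑ i, r i ^ 2) α * s.indicator 1 r :=
    (ht.comp (by fun_prop)).mul hind
  rw [← lintegral_indicator_one hs, lintegral_map hind hm, lintegral_weightedMeasure,
    Measure.smul_apply, smul_eq_mul, withDensity_apply _ hs,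
    Measure.restrict_restrict hs, ← lintegral_indicator (hs.inter hrad)]
  congr 1
  have h1 := lintegral_map (μ := (volume : Measure (Fin n → ℂ))) hg hm
  rw [← h1, map_norm_volume, lintegral_withDensity_eq_lintegral_mul _ (by fun_prop) hg,
    ← lintegral_indicator hpos]
  refine lintegral_congr fun r => ?_
  by_cases hr : r ∈ s ∩ radialBall n
  · rw [Set.indicator_of_mem hr]
    have hs1 : 0 < 1 - ∑ i, r i ^ 2 := sub_pos.2 hr.2.2
    by_cases hp : ∀ i, 0 < r i
    · rw [Set.indicator_of_mem (show r ∈ {r : Fin n → ℝ | ∀ i, 0 < r i} from hp)]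
      simp only [Pi.mul_apply, Set.indicator_of_mem hr.1, Pi.one_apply, mul_one, truncPow,
        if_pos hs1]
      rw [← ENNReal.ofReal_prod_of_nonneg fun i _ => by
        have := hp i
        have := Real.pi_pos
        positivity, mul_comm, ← ENNReal.ofReal_mul (by positivity)]
    · rw [Set.indicator_of_notMem (show r ∉ {r : Fin n → ℝ | ∀ i, 0 < r i} from hp)]
      push Not at hp
      obtain ⟨i, hi⟩ := hp
      have : r i = 0 := le_antisymm hi (hr.2.1 i)
      rw [Finset.prod_eq_zero (Finset.mem_univ i) (by rw [this, mul_zero]), mul_zero,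
        ENNReal.ofReal_zero]
  · rw [Set.indicator_of_notMem hr]
    by_cases hp : ∀ i, 0 < r i
    · rw [Set.indicator_of_mem (show r ∈ {r : Fin n → ℝ | ∀ i, 0 < r i} from hp)]
      simp only [Pi.mul_apply]
      by_cases hrs : r ∈ s
      · have : ¬ 0 < 1 - ∑ i, r i ^ 2 := fun h =>
          hr ⟨hrs, fun i => (hp i).le, sub_pos.1 h⟩
        rw [truncPow, if_neg this, zero_mul, mul_zero]
      · rw [Set.indicator_of_notMem hrs, mul_zero, mul_zero]
    · rw [Set.indicator_of_notMem (show r ∉ {r : Fin n → ℝ | ∀ i, 0 < r i} from hp)]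

/-! ### The spectral function -/

section Spectral

variable {n : ℕ} {α : ℝ} {a : (Fin n → ℂ) → ℂ} {b : (Fin n → ℝ) → ℂ}

lemma integrable_mul_basisMonomial_mul_conj (hα : -1 < α)
    (ha : MemLp a ∞ (weightedMeasure n α)) (m : Fin n → ℕ) :
    Integrable (fun z => a z * (basisMonomial α m z * conj (basisMonomial α m z)))
      (weightedMeasure n α) := by
  have := isProbabilityMeasure_weightedMeasure n hα
  have hc : Continuous fun z => basisMonomial α m z * conj (basisMonomial α m z) :=
    (continuous_basisMonomial α m).mul
      (Complex.continuous_conj.comp (continuous_basisMonomial α m))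
  obtain ⟨C, hC⟩ := exists_bound_on_unitBall hc
  exact (ha.integrable le_top).mul_bdd (c := C) hc.aestronglyMeasurable
    ((ae_weightedMeasure_mem_unitBall n α).mono hC)

/-- Passing to polar coordinates turns the diagonal matrix entries of `T_a` into the spectral
function. -/
lemma integrableOn_spectralIntegrand_and_toeplitzEigenvalue_eq (hα : -1 < α)
    (ha : MemLp a ∞ (weightedMeasure n α)) (hb : IsRadialProfile a b) (m : Fin n → ℕ) :
    IntegrableOn (spectralIntegrand α b m) (radialBall n) ∧
      toeplitzEigenvalue α a m = spectralFunction α b m := by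
  have hbm := hb.1
  have hae := (weightedMeasure_absolutelyContinuous n α).ae_le hb.2
  have hC := weightConst_pos n hα
  have hpi := Real.pi_pos
  have hnf : (0 : ℝ) < n.factorial := by exact_mod_cast n.factorial_pos
  have hC0 : 0 < weightConst n α * (n.factorial / Real.pi ^ n) := by positivity
  have h1 := gamma_pos_of_neg_one_lt n (∑ i, m i) hα
  have h2 := gamma_add_one_pos n hα
  have h3 : (0 : ℝ) < multiFactorial m := by exact_mod_cast multiFactorial_pos m
  have h4 : 0 < Real.Gamma (α + 1) := Real.Gamma_pos_of_pos (by linarith)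
  set K : ℝ := Real.Gamma (n + (∑ i, m i : ℕ) + α + 1) /
    (multiFactorial m * Real.Gamma (n + α + 1)) with hK
  have hK0 : 0 < K := by positivity
  set G : (Fin n → ℝ) → ℂ := fun r => b r * ((K * ∏ i, r i ^ (2 * m i) : ℝ) : ℂ) with hG
  have hGm : Measurable G := hbm.mul (Complex.measurable_ofReal.comp (by fun_prop))
  have hnm : Measurable fun (z : Fin n → ℂ) i => ‖z i‖ := by fun_prop
  have hGa : (fun z => a z * (basisMonomial α m z * conj (basisMonomial α m z)))
      =ᵐ[weightedMeasure n α] fun z => G fun i => ‖z i‖ := by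
    filter_upwards [hae] with z hz
    rw [hz, basisMonomial_mul_conj_self hα]
  have hD : Measurable fun r : Fin n → ℝ =>
      ENNReal.ofReal ((1 - ∑ i, r i ^ 2) ^ α * ∏ i, (2 * Real.pi * r i)) := by fun_prop
  have hDt : ∀ᵐ r : Fin n → ℝ ∂(volume.restrict (radialBall n)),
      ENNReal.ofReal ((1 - ∑ i, r i ^ 2) ^ α * ∏ i, (2 * Real.pi * r i)) < ∞ :=
    ae_of_all _ fun r => ENNReal.ofReal_lt_top
  have hDG : ∀ r ∈ radialBall n,
      (ENNReal.ofReal ((1 - ∑ i, r i ^ 2) ^ α * ∏ i, (2 * Real.pi * r i))).toReal • G r =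
        (((2 * Real.pi) ^ n * K : ℝ) : ℂ) * spectralIntegrand α b m r := by
    intro r hr
    have hs1 : 0 < 1 - ∑ i, r i ^ 2 := sub_pos.2 hr.2
    have hp : 0 ≤ ∏ i, (2 * Real.pi * r i) := Finset.prod_nonneg fun i _ => by
      have := hr.1 i
      positivity
    rw [ENNReal.toReal_ofReal (by positivity), hG, spectralIntegrand, Complex.real_smul,
      Finset.prod_mul_distrib, Finset.prod_const, Finset.card_univ, Fintype.card_fin]
    push_cast
    ring
  have hint : Integrable (fun r => (((2 * Real.pi) ^ n * K : ℝ) : ℂ) * spectralIntegrand α b m r)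
      (volume.restrict (radialBall n)) := by
    have e1 := (integrable_mul_basisMonomial_mul_conj hα ha m).congr hGa
    have e2 := (integrable_map_measure hGm.aestronglyMeasurable hnm.aemeasurable).2 e1
    rw [map_norm_weightedMeasure, integrable_smul_measure
      (ENNReal.ofReal_pos.2 hC0).ne' ENNReal.ofReal_ne_top,
      integrable_withDensity_iff_integrable_smul' hD hDt] at e2
    refine e2.congr ?_
    filter_upwards [ae_restrict_mem (measurableSet_radialBall n)] with r hr
    exact hDG r hr
  have hKpi : (((2 * Real.pi) ^ n * K : ℝ) : ℂ) ≠ 0 := by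
    have : 0 < (2 * Real.pi) ^ n * K := by positivity
    exact_mod_cast this.ne'
  refine ⟨(integrable_const_mul_iff (IsUnit.mk0 _ hKpi) _).1 hint, ?_⟩
  rw [toeplitzEigenvalue, integral_congr_ae hGa,
    ← integral_map hnm.aemeasurable hGm.aestronglyMeasurable, map_norm_weightedMeasure,
    integral_smul_measure, integral_withDensity_eq_integral_toReal_smul hD hDt,
    setIntegral_congr_fun (measurableSet_radialBall n) hDG, integral_const_mul,
    ENNReal.toReal_ofReal hC0.le, spectralFunction, Complex.real_smul, ← mul_assoc,
    ← Complex.ofReal_mul]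
  congr 2
  rw [hK, weightConst, mul_pow]
  field_simp

end Spectral

/-! ### Symmetric separately radial symbols -/

section Invariance

lemma measurePreserving_permTorusAct_restrict {n : ℕ} (σ : Equiv.Perm (Fin n))
    (t : Fin n → Circle) :
    MeasurePreserving (permTorusAct σ t) (volume.restrict (unitBall n))
      (volume.restrict (unitBall n)) := by
  have h := (measurePreserving_permTorusAct σ t).restrict_preimage
    (isOpen_unitBall n).measurableSet
  have hpre : permTorusAct σ t ⁻¹' unitBall n = unitBall n := by
    ext z
    simp [unitBall, sum_norm_sq_permTorusAct]
  rwa [hpre] at h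

lemma IsSymmetricSeparatelyRadial.isPermTorusInvariant {n : ℕ} {a : (Fin n → ℂ) → ℂ}
    (ha : IsSymmetricSeparatelyRadial a) : IsPermTorusInvariant a := by
  obtain ⟨-, ⟨b, -, hb⟩, hσ⟩ := ha
  intro σ t
  have h1 := (measurePreserving_permTorusAct_restrict σ t).quasiMeasurePreserving.ae hb
  have h2 := (measurePreserving_permTorusAct_restrict σ 1).quasiMeasurePreserving.ae hb
  filter_upwards [h1, h2, hσ σ] with z e1 e2 e3
  have h3 : permTorusAct σ 1 z = fun i => z (σ i) := by ext i; simp [permTorusAct]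
  rw [e1, ← e3, ← h3, e2]
  simp only [permTorusAct, norm_mul, Circle.norm_coe]

/-- A function invariant under the torus, for each rotation almost everywhere, is almost everywhere
a function of the radii: a profile is given by its average over the torus. -/
lemma exists_isRadialProfile {n : ℕ} {a : (Fin n → ℂ) → ℂ}
    (hm : AEStronglyMeasurable a (volume.restrict (unitBall n)))
    (ha : ∀ t : Fin n → Circle, ∀ᵐ z ∂(volume.restrict (unitBall n)),
      a (permTorusAct 1 t z) = a z) : ∃ b, IsRadialProfile a b := by
  set a' := hm.mk a with ha'
  have ham : StronglyMeasurable a' := hm.stronglyMeasurable_mk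
  have haa : a =ᵐ[volume.restrict (unitBall n)] a' := hm.ae_eq_mk
  set τ : (Fin n → UnitAddCircle) → Fin n → Circle := fun x i => AddCircle.toCircle (x i) with hτ
  have hτc : Continuous fun p : (Fin n → UnitAddCircle) × (Fin n → ℂ) =>
      permTorusAct 1 (τ p.1) p.2 := by
    have := AddCircle.continuous_toCircle (T := 1)
    change Continuous fun p : (Fin n → UnitAddCircle) × (Fin n → ℂ) =>
      fun i => (AddCircle.toCircle (p.1 i) : ℂ) * p.2 i
    fun_prop
  have hinv : ∀ᵐ z ∂(volume.restrict (unitBall n)), ∀ᵐ x : Fin n → UnitAddCircle,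
      a' (permTorusAct 1 (τ x) z) = a' z := by
    refine (Measure.ae_ae_comm (p := fun (x : Fin n → UnitAddCircle) (z : Fin n → ℂ) =>
      a' (permTorusAct 1 (τ x) z) = a' z) ?_).1 (ae_of_all _ fun x => ?_)
    · exact measurableSet_eq_fun (ham.measurable.comp hτc.measurable)
        (ham.measurable.comp measurable_snd)
    · have h := (measurePreserving_permTorusAct_restrict 1 (τ x)).quasiMeasurePreserving.ae haa
      filter_upwards [h, haa, ha (τ x)] with z e1 e2 e3
      rw [← e1, ← e2, e3]
  refine ⟨fun r => ∫ x : Fin n → UnitAddCircle, a' (permTorusAct 1 (τ x) fun i => (r i : ℂ)),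
    ?_, ?_⟩
  · have hc : Continuous fun p : (Fin n → ℝ) × (Fin n → UnitAddCircle) =>
        permTorusAct 1 (τ p.2) fun i => (p.1 i : ℂ) := by
      have h : Continuous fun p : (Fin n → ℝ) × (Fin n → UnitAddCircle) =>
        (p.2, fun i => (p.1 i : ℂ)) := by fun_prop
      exact hτc.comp h
    exact (StronglyMeasurable.integral_prod_right' (ham.comp_measurable hc.measurable)).measurable
  · filter_upwards [haa, hinv] with z e1 e2
    -- write `z` as a rotation of its vector of absolute values
    have hs : ∀ i, ∃ y : UnitAddCircle, (AddCircle.toCircle y : ℂ) * ‖z i‖ = z i := by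
      intro i
      obtain ⟨y, hy⟩ := (AddCircle.homeomorphCircle (T := 1) one_ne_zero).surjective
        (Circle.exp (Complex.arg (z i)))
      refine ⟨y, ?_⟩
      rw [AddCircle.homeomorphCircle_apply] at hy
      rw [hy, Circle.coe_exp, mul_comm, Complex.norm_mul_exp_arg_mul_I]
    choose y hy using hs
    have h1 : ∀ x, permTorusAct 1 (τ x) z = permTorusAct 1 (τ (x + y)) fun i => (‖z i‖ : ℂ) := by
      intro x
      ext i
      simp only [permTorusAct, hτ, Equiv.Perm.coe_one, id_eq, Pi.add_apply,
        AddCircle.toCircle_add, Circle.coe_mul]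
      rw [mul_assoc, hy]
    have h2 : ∫ x : Fin n → UnitAddCircle, a' (permTorusAct 1 (τ x) z) = a' z := by
      rw [integral_congr_ae e2, integral_const, measureReal_def, volume_pi, Measure.pi_univ]
      simp
    simp_rw [h1] at h2
    rw [integral_add_right_eq_self
      (fun x => a' (permTorusAct 1 (τ x) fun i => (‖z i‖ : ℂ)))] at h2
    rw [e1, ← h2]

lemma IsPermTorusInvariant.isSymmetricSeparatelyRadial {n : ℕ} {a : (Fin n → ℂ) → ℂ}
    (hL : MemLp a ∞ (volume.restrict (unitBall n))) (ha : IsPermTorusInvariant a) :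
    IsSymmetricSeparatelyRadial a := by
  refine ⟨hL, exists_isRadialProfile hL.1 fun t => ha 1 t, fun σ => ?_⟩
  filter_upwards [ha σ 1] with z hz
  rw [← hz]
  congr 1
  ext i
  simp [permTorusAct]

end Invariance

/-! ### The decomposition of `ℓ²` into orbits -/

section HilbertSum

lemma exists_decreasingIndex_mem_indexOrbit {n : ℕ} (m : Fin n → ℕ) :
    ∃ ι : DecreasingIndex n, m ∈ indexOrbit (ι : Fin n → ℕ) := by
  set σ := Tuple.sort (OrderDual.toDual ∘ m) with hσ
  have h : Monotone ((OrderDual.toDual ∘ m) ∘ σ) := Tuple.monotone_sort _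
  refine ⟨⟨m ∘ σ, fun i j hij => h hij⟩, σ⁻¹, ?_⟩
  funext i
  simp

/-- The orbits of distinct decreasing indices are disjoint. -/
lemma decreasingIndex_eq_of_mem_indexOrbit {n : ℕ} {ι κ : DecreasingIndex n} {m : Fin n → ℕ}
    (h1 : m ∈ indexOrbit (ι : Fin n → ℕ)) (h2 : m ∈ indexOrbit (κ : Fin n → ℕ)) : ι = κ := by
  obtain ⟨σ, rfl⟩ := h1
  obtain ⟨τ, h⟩ := h2
  have e : (ι : Fin n → ℕ) ∘ (τ⁻¹.trans σ) = κ := by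
    funext i
    have := congrFun h (τ⁻¹ i)
    simpa using this
  have h3 : Antitone ((ι : Fin n → ℕ) ∘ (τ⁻¹.trans σ)) := by rw [e]; exact κ.2
  have h4 : Antitone ((ι : Fin n → ℕ) ∘ (1 : Equiv.Perm (Fin n))) := ι.2
  have h5 := Tuple.unique_antitone h4 h3
  rw [e] at h5
  exact Subtype.ext h5

lemma single_mem_orbitEllTwo {n : ℕ} {ι m : Fin n → ℕ} (hm : m ∈ indexOrbit ι) (c : ℂ) :
    (lp.single 2 m c : EllTwo n) ∈ orbitEllTwo ι := by
  intro k hk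
  have : k ≠ m := fun h => hk (h ▸ hm)
  simp [lp.single_apply, this]

lemma isClosed_orbitEllTwo {n : ℕ} (ι : Fin n → ℕ) :
    IsClosed (orbitEllTwo ι : Set (EllTwo n)) := by
  have h : (orbitEllTwo ι : Set (EllTwo n)) = ⋂ m ∉ indexOrbit ι,
      {x : EllTwo n | inner ℂ (lp.single 2 m (1 : ℂ) : EllTwo n) x = 0} := by
    ext x
    simp only [Set.mem_iInter, Set.mem_ofPred_eq, lp.inner_single_left, RCLike.inner_apply,
      map_one, mul_one]
    rfl
  rw [h]
  exact isClosed_biInter fun m _ => isClosed_eq (by fun_prop) continuous_const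

lemma isHilbertSum_orbitEllTwo (n : ℕ) :
    IsHilbertSum ℂ (fun ι : DecreasingIndex n => orbitEllTwo (ι : Fin n → ℕ))
      (fun ι => (orbitEllTwo (ι : Fin n → ℕ)).subtypeₗᵢ) := by
  have hc : ∀ ι : DecreasingIndex n, CompleteSpace (orbitEllTwo (ι : Fin n → ℕ)) := fun ι =>
    (isClosed_orbitEllTwo _).completeSpace_coe
  refine IsHilbertSum.mkInternal
    (F := fun ι : DecreasingIndex n => orbitEllTwo (ι : Fin n → ℕ)) ?_ ?_
  · intro ι κ hικ x y
    change inner ℂ (x : EllTwo n) (y : EllTwo n) = 0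
    rw [lp.inner_eq_tsum]
    refine (tsum_congr fun m => ?_).trans tsum_zero
    by_cases h1 : m ∈ indexOrbit (ι : Fin n → ℕ)
    · have h2 : m ∉ indexOrbit (κ : Fin n → ℕ) := fun h2 =>
        hικ (decreasingIndex_eq_of_mem_indexOrbit h1 h2)
      rw [y.2 m h2, inner_zero_right]
    · rw [x.2 m h1, inner_zero_left]
  · rw [top_le_iff, Submodule.topologicalClosure_eq_top_iff, Submodule.eq_bot_iff]
    intro x hx
    refine lp.ext (funext fun m => ?_)
    obtain ⟨ι, hι⟩ := exists_decreasingIndex_mem_indexOrbit m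
    have h := hx _ (Submodule.mem_iSup_of_mem ι (single_mem_orbitEllTwo hι 1))
    rw [lp.inner_single_left] at h
    simpa using h

end HilbertSum

/-! ### Commutativity and diagonalization -/

theorem mainTheorem5 (n : ℕ) (hn : 1 ≤ n) (α : ℝ) (hα : -1 < α) :
    -- the symmetric separately radial symbols are the invariant ones
    (∀ a : (Fin n → ℂ) → ℂ, MemLp a ∞ (volume.restrict (unitBall n)) →
      (IsSymmetricSeparatelyRadial a ↔ IsPermTorusInvariant a)) ∧
    -- the generated algebra is commutative
    (∀ S ∈ symToeplitzAlgebra n α, ∀ T ∈ symToeplitzAlgebra n α, S * T = T * S) ∧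
    -- `ℓ²(ℤ₊ⁿ)` is the Hilbert sum of the `ℓ²(𝓘_ι)`
    IsHilbertSum ℂ (fun ι : DecreasingIndex n => orbitEllTwo (ι : Fin n → ℕ))
      (fun ι => (orbitEllTwo (ι : Fin n → ℕ)).subtypeₗᵢ) ∧
    -- `R f = (⟨f, e_m⟩)_m` is unitary and diagonalizes all the operators
    ∃ R : bergmanSpace n α ≃ₗᵢ[ℂ] EllTwo n,
      (∀ (f : bergmanSpace n α) (m : Fin n → ℕ),
        R f m = ∫ z, (f : Lp ℂ 2 (weightedMeasure n α)) z * conj (basisMonomial α m z)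
          ∂(weightedMeasure n α)) ∧
      ∀ a : (Fin n → ℂ) → ℂ, IsSymmetricSeparatelyRadial a →
        (∃! T : bergmanSpace n α →L[ℂ] bergmanSpace n α, IsToeplitzOperator a T) ∧
        ∀ b : (Fin n → ℝ) → ℂ, IsRadialProfile a b →
          (∀ m : Fin n → ℕ, IntegrableOn (spectralIntegrand α b m) (radialBall n)) ∧
          (∀ T : bergmanSpace n α →L[ℂ] bergmanSpace n α, IsToeplitzOperator a T →
            (∀ ι : DecreasingIndex n, ∀ x ∈ orbitEllTwo (ι : Fin n → ℕ),
              R (T (R.symm x)) = spectralFunction α b ι • x) ∧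
            (∀ (x : EllTwo n) (m : Fin n → ℕ),
              R (T (R.symm x)) m = spectralFunction α b m * x m)) ∧
          (∀ (ι : DecreasingIndex n), ∀ m ∈ indexOrbit (ι : Fin n → ℕ),
            spectralFunction α b m = spectralFunction α b ι) := by
  have hmem : ∀ a : (Fin n → ℂ) → ℂ, IsSymmetricSeparatelyRadial a →
      MemLp a ∞ (weightedMeasure n α) := fun a ha =>
    ⟨ha.1.1.mono_ac (weightedMeasure_absolutelyContinuous n α),
      (eLpNormEssSup_mono_measure a (weightedMeasure_absolutelyContinuous n α)).trans_lt (by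
        simpa using ha.1.2)⟩
  have hdiag : ∀ (a : (Fin n → ℂ) → ℂ), IsSymmetricSeparatelyRadial a →
      ∀ T : bergmanSpace n α →L[ℂ] bergmanSpace n α, IsToeplitzOperator a T →
        IsDiagonalWith (bergmanBasis hα) (toeplitzEigenvalue α a) T := by
    intro a ha T hT
    rw [hT.unique (isToeplitzOperator_toeplitzOperator hα (hmem a ha))]
    exact isDiagonalWith_toeplitzOperator hα (hmem a ha) fun t =>
      (weightedMeasure_absolutelyContinuous n α).ae_le (ha.isPermTorusInvariant 1 t)
  refine ⟨fun a hL => ⟨fun h => h.isPermTorusInvariant, fun h => h.isSymmetricSeparatelyRadial hL⟩,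
    ?_, isHilbertSum_orbitEllTwo n, (bergmanBasis hα).repr, fun f m => ?_, fun a ha => ⟨?_, ?_⟩⟩
  · refine generatedCStarAlgebra_mul_comm (bergmanBasis hα) ?_
    rintro T ⟨a, ha, hT⟩
    exact ⟨_, hdiag a ha T hT⟩
  · rw [HilbertBasis.repr_apply_apply, bergmanBasis_apply]
    exact inner_bergmanMonomial_Lp hα m _
  · exact ⟨_, isToeplitzOperator_toeplitzOperator hα (hmem a ha), fun T hT =>
      hT.unique (isToeplitzOperator_toeplitzOperator hα (hmem a ha))⟩
  · intro b hb
    have hspec := integrableOn_spectralIntegrand_and_toeplitzEigenvalue_eq hα (hmem a ha) hb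
    have hsymm : ∀ (ι : DecreasingIndex n), ∀ m ∈ indexOrbit (ι : Fin n → ℕ),
        spectralFunction α b m = spectralFunction α b ι := by
      rintro ι m ⟨σ, rfl⟩
      rw [← (hspec _).2, ← (hspec _).2]
      exact toeplitzEigenvalue_comp_perm σ
        ((weightedMeasure_absolutelyContinuous n α).ae_le (ha.2.2 σ)) _
    have hmul : ∀ T : bergmanSpace n α →L[ℂ] bergmanSpace n α, IsToeplitzOperator a T →
        ∀ (x : EllTwo n) (m : Fin n → ℕ), (bergmanBasis hα).repr
          (T ((bergmanBasis hα).repr.symm x)) m = spectralFunction α b m * x m := by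
      intro T hT x m
      rw [hdiag a ha T hT, (hspec m).2, LinearIsometryEquiv.apply_symm_apply]
    refine ⟨fun m => (hspec m).1, fun T hT => ⟨fun ι x hx => ?_, hmul T hT⟩, hsymm⟩
    refine lp.ext (funext fun m => ?_)
    rw [hmul T hT, lp.coeFn_smul, Pi.smul_apply, smul_eq_mul]
    by_cases hm : m ∈ indexOrbit (ι : Fin n → ℕ)
    · rw [hsymm ι m hm]
    · rw [hx m hm, mul_zero, mul_zero]
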